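/- Let $\mathcal M\subseteq M_n(\mathbb C)$ be a unital $*$-subalgebra (a finite-dimensional von Neumann algebra) and $\mathcal N\subseteq\mathcal M$ a unital $*$-subalgebra. For $X\in\mathcal M$ let $X_{\mathcal N}$ be the orthogonal projection of $X$ onto $\mathcal N$ with respect to $\langle X,Y\rangle=\mathrm{Tr}[X^*Y]$, and let $\|X\|_2=\mathrm{Tr}[X^*X]^{1/2}$. For $A\ge 0$ and $s\in\mathbb R$, $A^s$ is taken on the support of $A$ (so $A^{-1}$ is the pseudo-inverse and $A^0$ is the support projection). For density matrices $\rho,\sigma\in\mathcal M$ (positive semidefinite, trace one) let $S(\rho\|\sigma)=\mathrm{Tr}(\rho\log\rho-\rho\log\sigma)$ if $\ker\sigma\subseteq\ker\rho$ and $S(\rho\|\sigma)=+\infty$ otherwise, and let $\|\Delta_{\sigma,\rho}\|$ be the operator norm of $X\mapsto\sigma X\rho^{-1}$ on $(M_n(\mathbb C),\|\cdot\|_2)$. For $d\ge0$ put $$K^L_\beta(d)=\Big(\tfrac{\pi(1-2\beta+2\beta^2)\beta}{\sin\beta\pi}\Big)^{\frac1{\beta(1-\beta)}}\Big(1+\tfrac{\beta}{1-\beta}d\Big)^{-\frac{1-2\beta+2\beta^2}{\beta(1-\beta)}}2^{-\frac{1-2\beta+2\beta^2}{\beta(1-\beta)}}\Big(\tfrac{1-2\beta+2\beta^2}{2(1-\beta)}\Big)^{-2},$$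 $$K^U_\beta(d)=\Big(\tfrac{\pi\beta(1-\beta)}{\sin\beta\pi}\Big)^{\frac2{1-\beta}}\Big(\tfrac{1-\beta}{\beta}+d\Big)^{-\frac{2\beta}{1-\beta}}2^{-\frac{2\beta}{1-\beta}}\beta^{-2}.$$ (a) If $\rho$ is invertible, then with $d=\|\Delta_{\sigma,\rho}\|$: * for $0<\beta<1/2$, $\;S(\rho\|\sigma)-S(\rho_{\mathcal N}\|\sigma_{\mathcal N})\ge K^L_\beta(d)\,\|\sigma_{\mathcal N}^{\beta}\rho_{\mathcal N}^{-\beta}\rho^{1/2}-\sigma^\beta\rho^{\frac12-\beta}\|_2^{\frac1{\beta(1-\beta)}}$; * for $1/2\le\beta<1$, $\;S(\rho\|\sigma)-S(\rho_{\mathcal N}\|\sigma_{\mathcal N})\ge K^U_\beta(d)\,\|\sigma_{\mathcal N}^{\beta}\rho_{\mathcal N}^{-\beta}\rho^{1/2}-\sigma^\beta\rho^{\frac12-\beta}\|_2^{\frac2{1-\beta}}$; * in particular, $\;S(\rho\|\sigma)-S(\rho_{\mathcal N}\|\sigma_{\mathcal N})\ge(\pi/4)^4(1+d)^{-2}\,\|\sigma_{\mathcal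 N}^{1/2}\rho_{\mathcal N}^{-1/2}\rho^{1/2}-\sigma^{1/2}\|_2^4$. (b) If $\rho$ is an arbitrary density matrix in $\mathcal M$, the same three inequalities hold with $d=\max\{\|\Delta_{\sigma,\rho}\|,\|\Delta_{\sigma_{\mathcal N},\rho_{\mathcal N}}\|\}$ and, in the third one, $\sigma^{1/2}\rho^0$ in place of the last term $\sigma^{1/2}$. Each inequality is read as $S(\rho\|\sigma)\ge S(\rho_{\mathcal N}\|\sigma_{\mathcal N})+\dots$ in $(-\infty,+\infty]$. -/

import Mathlib

open scoped Matrix ComplexOrder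

noncomputable section

namespace QRE

variable {n : Type*} [Fintype n]

/-- A density matrix: positive semidefinite with unit trace. -/
def IsDensity (ρ : Matrix n n ℂ) : Prop :=
  ρ.PosSemidef ∧ ρ.trace = 1

/-- The Hilbert-Schmidt space: `M_n(ℂ)` identified, entry by entry, with `ℂ^(n × n)` carrying its
Euclidean inner product; see `inner_toHS` for `⟪X, Y⟫ = Tr (X* Y)`. -/
def toHS : Matrix n n ℂ ≃ₗ[ℂ] EuclideanSpace ℂ (n × n) :=
  (LinearEquiv.curry ℂ ℂ n n).symm.trans (WithLp.linearEquiv 2 ℂ (n × n → ℂ)).symm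

theorem inner_toHS (X Y : Matrix n n ℂ) :
    inner ℂ (toHS X) (toHS Y) = (Xᴴ * Y).trace := by
  simp only [PiLp.inner_apply, Matrix.trace, Matrix.diag, Matrix.mul_apply,
    Matrix.conjTranspose_apply, Fintype.sum_prod_type]
  rw [Finset.sum_comm]
  refine Finset.sum_congr rfl fun i _ => Finset.sum_congr rfl fun j _ => ?_
  exact mul_comm _ _

/-- The Hilbert-Schmidt (Schatten 2-) norm. -/
def hsNorm (X : Matrix n n ℂ) : ℝ := ‖toHS X‖

variable [DecidableEq n]

/-- Operator norm of a linear map on `M_n(ℂ)` equipped with the Hilbert-Schmidt norm. -/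
def hsOpNorm (L : Matrix n n ℂ →ₗ[ℂ] Matrix n n ℂ) : ℝ :=
  ‖LinearMap.toContinuousLinearMap (toHS.toLinearMap ∘ₗ L ∘ₗ toHS.symm.toLinearMap)‖

/-- Orthogonal projection, for the Hilbert-Schmidt inner product, onto the subalgebra `N`
(the tracial conditional expectation). -/
def condExp (N : StarSubalgebra ℂ (Matrix n n ℂ)) (X : Matrix n n ℂ) : Matrix n n ℂ :=
  toHS.symm
    ((N.toSubalgebra.toSubmodule.map toHS.toLinearMap).starProjection (toHS X))

theorem condExp_mem (N : StarSubalgebra ℂ (Matrix n n ℂ)) (X : Matrix n n ℂ) :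
    condExp N X ∈ N := by
  have h := Submodule.starProjection_apply_mem
    (N.toSubalgebra.toSubmodule.map (toHS (n := n)).toLinearMap) (toHS X)
  obtain ⟨Y, hY, hYX⟩ := h
  have : condExp N X = Y := by
    rw [condExp, ← hYX]; simp
  rw [this]; exact hY

theorem trace_condExp (N : StarSubalgebra ℂ (Matrix n n ℂ)) (X Z : Matrix n n ℂ) (hZ : Z ∈ N) :
    (Zᴴ * (X - condExp N X)).trace = 0 := by
  have h := Submodule.sub_starProjection_mem_orthogonal
    (K := N.toSubalgebra.toSubmodule.map (toHS (n := n)).toLinearMap) (toHS X)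
  have h2 := h (toHS Z) ⟨Z, hZ, rfl⟩
  rw [← inner_toHS, map_sub, condExp, LinearEquiv.apply_symm_apply]
  exact h2

/-- Real power `A^s` of a positive semidefinite matrix, taken on its support:
`∑ λ^s P_λ` over the nonzero eigenvalues `λ`. Thus `A^(-1)` is the pseudo-inverse and
`A^0` is the projection onto the support of `A`. -/
def mpow (A : Matrix n n ℂ) (s : ℝ) : Matrix n n ℂ :=
  cfc (fun x : ℝ => if x = 0 then 0 else x ^ s) A

/-- Logarithm of a positive semidefinite matrix, taken on its support. -/
def mlog (A : Matrix n n ℂ) : Matrix n n ℂ :=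
  cfc Real.log A

open Classical in
/-- Umegaki relative entropy: `Tr (ρ log ρ - ρ log σ)` if `ker σ ⊆ ker ρ`, and `+∞` otherwise. -/
def relEntropy (ρ σ : Matrix n n ℂ) : EReal :=
  if LinearMap.ker σ.mulVecLin ≤ LinearMap.ker ρ.mulVecLin then
    (((ρ * mlog ρ - ρ * mlog σ).trace.re : ℝ) : EReal)
  else ⊤

/-- The relative modular operator `X ↦ σ X ρ⁻¹` (pseudo-inverse if `ρ` is singular). -/
def relModular (σ ρ : Matrix n n ℂ) : Matrix n n ℂ →ₗ[ℂ] Matrix n n ℂ :=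
  LinearMap.mulLeft ℂ σ ∘ₗ LinearMap.mulRight ℂ (mpow ρ (-1))

/-- `‖σ_N^β ρ_N^(-β) ρ^(1/2) - σ^β ρ^(1/2-β)‖₂`. -/
def defect (N : StarSubalgebra ℂ (Matrix n n ℂ)) (ρ σ : Matrix n n ℂ) (β : ℝ) : ℝ :=
  hsNorm (mpow (condExp N σ) β * mpow (condExp N ρ) (-β) * mpow ρ (1 / 2)
    - mpow σ β * mpow ρ (1 / 2 - β))

/-- The constant for `β < 1/2`, as a function of `d`, the norm of the relative modular operator. -/
def constL (β d : ℝ) : ℝ :=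
  (Real.pi * (1 - 2 * β + 2 * β ^ 2) * β / Real.sin (β * Real.pi)) ^ (1 / (β * (1 - β)))
    * (1 + β / (1 - β) * d) ^ (-((1 - 2 * β + 2 * β ^ 2) / (β * (1 - β))))
    * (2 : ℝ) ^ (-((1 - 2 * β + 2 * β ^ 2) / (β * (1 - β))))
    * ((1 - 2 * β + 2 * β ^ 2) / (2 * (1 - β))) ^ (-2 : ℝ)

/-- The constant for `β ≥ 1/2`, as a function of `d`, the norm of the relative modular operator. -/
def constU (β d : ℝ) : ℝ :=
  (Real.pi * β * (1 - β) / Real.sin (β * Real.pi)) ^ (2 / (1 - β))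
    * ((1 - β) / β + d) ^ (-(2 * β / (1 - β)))
    * (2 : ℝ) ^ (-(2 * β / (1 - β)))
    * β ^ (-2 : ℝ)

end QRE

end

/-! Let Δ be the relative modular operator of (σ, ρ), Δ_N that of (σ_N, ρ_N), and D the entropy
difference. Since -log x = ∫ ((t + x)⁻¹ - (1 + t)⁻¹) dt over t > 0, both entropies are integrals of
the resolvent forms ⟨ρ^(1/2), (t + Δ)⁻¹ ρ^(1/2)⟩ (`integral_trace_modularResolvent`).

The map U : X ↦ X ρ_N^(-1/2) ρ^(1/2) is a partial isometry on N with U ρ_N^(1/2) = ρ^(1/2) and U*ΔU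
≤ Δ_N. Let v(t) be the norm of U (t + Δ_N)⁻¹ ρ_N^(1/2) - (t + Δ)⁻¹ ρ^(1/2). Completing the square
gives t v(t)² ≤ the difference of the two resolvent forms (`mul_hsNorm_transfer_sub_sq_le`), hence ∫
t v² ≤ D.

On the other side, π / sin(βπ) · x^β = ∫ t^β (t⁻¹ - (t + x)⁻¹) dt for 0 < β < 1. Applied to Δ and
Δ_N, it bounds π / sin(βπ) times the defect by ∫ t^β v (`integrableOn_rpow_mul_resolventGap`).

It remains to bound ∫ t^β v by D. The range is cut at ε and T: v ≤ 2/t near 0, Cauchy-Schwarz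
against ∫ t v² in the middle, v ≤ 2d/t² in the tail. Optimising the cuts yields the exponents and
constants; β = 1/2 gives the third inequality. -/

section ScalarIntegrals

open Set MeasureTheory Filter Real

/-! ### Scalar integrals and optimisation of the cut-offs. -/

/-- This is the Beta integral B(p, 1 - p) = Γ(p) Γ(1 - p), evaluated by Euler's reflection formula.
-/
theorem integral_rpow_mul_one_sub_rpow_neg {p : ℝ} (hp : p ∈ Ioo (0 : ℝ) 1) :
    ∫ u in Ioo (0 : ℝ) 1, u ^ (p - 1) * (1 - u) ^ (-p) = π / sin (p * π) := by
  have h1 := Complex.Gamma_mul_Gamma_eq_betaIntegral (s := p) (t := ((1 - p : ℝ) : ℂ))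
    (by simpa using hp.1) (by simpa using hp.2)
  have h2 : Complex.Gamma (p : ℂ) * Complex.Gamma ((1 - p : ℝ) : ℂ) =
      ((π / sin (p * π) : ℝ) : ℂ) := by
    push_cast
    rw [Complex.Gamma_mul_Gamma_one_sub, mul_comm (p : ℂ)]
  rw [h2] at h1
  have h3 : (p : ℂ) + ((1 - p : ℝ) : ℂ) = 1 := by push_cast; ring
  rw [h3, Complex.Gamma_one, one_mul, Complex.betaIntegral,
    intervalIntegral.integral_of_le zero_le_one, ← integral_Ioc_eq_integral_Ioo.symm] at h1
  have h4 : ∫ u : ℝ in Ioo 0 1, (u : ℂ) ^ ((p : ℂ) - 1) * (1 - (u : ℂ)) ^ (((1 - p : ℝ) : ℂ) - 1)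
      = ((∫ u in Ioo (0 : ℝ) 1, u ^ (p - 1) * (1 - u) ^ (-p) : ℝ) : ℂ) := by
    rw [← integral_complex_ofReal]
    refine setIntegral_congr_fun measurableSet_Ioo fun u hu => ?_
    rw [Complex.ofReal_mul, Complex.ofReal_cpow hu.1.le, Complex.ofReal_cpow (by linarith [hu.2])]
    push_cast
    congr 2
    ring
  rw [h4] at h1
  exact_mod_cast h1.symm

theorem image_div_one_add_Ioi : (fun t : ℝ => t / (1 + t)) '' Ioi 0 = Ioo 0 1 := by
  ext u
  constructor
  · rintro ⟨t, ht, rfl⟩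
    have ht : 0 < t := ht
    refine ⟨by positivity, ?_⟩
    simp only
    rw [div_lt_one (by positivity)]
    linarith
  · rintro ⟨h0, h1⟩
    have : 0 < 1 - u := by linarith
    refine ⟨u / (1 - u), div_pos h0 this, ?_⟩
    simp only
    field_simp
    ring

/-- The substitution u = t / (1 + t) reduces t^(p-1) / (1 + t) to the Beta integral. -/
theorem integral_rpowIntegrand₀₁_one {p : ℝ} (hp : p ∈ Ioo (0 : ℝ) 1) :
    ∫ t in Ioi 0, rpowIntegrand₀₁ p t 1 = π / sin (p * π) := by
  rw [← integral_rpow_mul_one_sub_rpow_neg hp, ← image_div_one_add_Ioi,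
    integral_image_eq_integral_abs_deriv_smul (f' := fun t => 1 / (1 + t) ^ 2) measurableSet_Ioi]
  · refine setIntegral_congr_fun measurableSet_Ioi fun t ht => ?_
    have ht : 0 < t := ht
    have h1 : 0 < 1 + t := by positivity
    have h2 : 1 - t / (1 + t) = (1 + t)⁻¹ := by field_simp; ring
    simp only [smul_eq_mul]
    rw [h2, rpowIntegrand₀₁_eq_pow_div hp ht.le zero_le_one, abs_of_pos (by positivity),
      div_rpow ht.le h1.le, inv_rpow h1.le, rpow_neg h1.le, inv_inv]
    rw [show (1 + t) ^ p = (1 + t) ^ (p - 1) * (1 + t) by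
      rw [← rpow_add_one h1.ne']; ring_nf]
    have := (rpow_pos_of_pos h1 (p - 1)).ne'
    field_simp
    rw [add_comm]
  · intro t ht
    have h1 : (1 + t) ≠ 0 := by have : 0 < t := ht; positivity
    have := ((hasDerivAt_id t).div ((hasDerivAt_id t).const_add 1) h1).hasDerivWithinAt (s := Ioi 0)
    exact this.congr_deriv (by simp)
  · intro x hx y hy hxy
    have hx : 0 < x := hx
    have hy : 0 < y := hy
    replace hxy : x / (1 + x) = y / (1 + y) := hxy
    rw [div_eq_div_iff (by positivity) (by positivity)] at hxy
    linarith

theorem integral_rpowIntegrand₀₁ {p x : ℝ} (hp : p ∈ Ioo (0 : ℝ) 1) (hx : 0 ≤ x) :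
    ∫ t in Ioi 0, rpowIntegrand₀₁ p t x = π / sin (p * π) * x ^ p := by
  rw [integral_rpowIntegrand₀₁_eq_rpow_mul_const hp hx, integral_rpowIntegrand₀₁_one hp, mul_comm]

theorem tendsto_log_add_sub_log_one_add (x : ℝ) :
    Tendsto (fun t : ℝ => log (t + x) - log (1 + t)) atTop (nhds 0) := by
  have h1 : Tendsto (fun t : ℝ => 1 + (x - 1) / (1 + t)) atTop (nhds (1 + 0)) :=
    (tendsto_const_nhds.div_atTop (tendsto_atTop_add_const_left _ _ tendsto_id)).const_add 1
  rw [add_zero] at h1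
  have h2 := (continuousAt_log one_ne_zero).tendsto.comp h1
  rw [log_one] at h2
  refine h2.congr' ?_
  filter_upwards [eventually_gt_atTop 0, eventually_gt_atTop (-x)] with t ht htx
  have ht1 : 1 + t ≠ 0 := by positivity
  rw [← log_div (by linarith) ht1]
  simp only [Function.comp]
  congr 1
  field_simp
  ring

theorem integrableOn_and_integral_inv_add_sub {x : ℝ} (hx : 0 < x) :
    IntegrableOn (fun t : ℝ => (t + x)⁻¹ - (1 + t)⁻¹) (Ioi 0) ∧
      ∫ t in Ioi 0, ((t + x)⁻¹ - (1 + t)⁻¹) = - log x := by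
  have hd : ∀ t ∈ Ici (0 : ℝ), HasDerivAt (fun t : ℝ => log (t + x) - log (1 + t))
      ((t + x)⁻¹ - (1 + t)⁻¹) t := by
    intro t ht
    have ht : 0 ≤ t := ht
    have h1 := ((hasDerivAt_id t).add_const x).log (by simp; positivity)
    have h2 := ((hasDerivAt_id t).const_add 1).log (by simp; positivity)
    simp only [id_eq, one_div] at h1 h2
    exact h1.sub h2
  have hlim := tendsto_log_add_sub_log_one_add x
  have hint : IntegrableOn (fun t : ℝ => (t + x)⁻¹ - (1 + t)⁻¹) (Ioi 0) := by
    -- The integrand has constant sign, which depends on whether x ≤ 1; with the limit of the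
    -- antiderivative this gives integrability.
    rcases le_total x 1 with h | h
    · refine integrableOn_Ioi_deriv_of_nonneg' hd (fun t ht => ?_) hlim
      have ht : 0 < t := ht
      rw [sub_nonneg]
      exact inv_anti₀ (by positivity) (by linarith)
    · refine integrableOn_Ioi_deriv_of_nonpos' hd (fun t ht => ?_) hlim
      have ht : 0 < t := ht
      rw [sub_nonpos]
      exact inv_anti₀ (by positivity) (by linarith)
  refine ⟨hint, ?_⟩
  rw [integral_Ioi_of_hasDerivAt_of_tendsto' hd hint hlim]
  simp

/-- The quadratic A r² - 2Y r + D is nonnegative for every r, so its discriminant is not positive.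
With a free r, Cauchy-Schwarz becomes a pointwise AM-GM bound that needs no square integrability. -/
theorem le_sqrt_mul_of_forall_le {Y A D : ℝ} (hY : 0 ≤ Y) (hA : 0 ≤ A) (hD : 0 ≤ D)
    (h : ∀ r : ℝ, 0 < r → Y ≤ (r * A + D / r) / 2) : Y ≤ √(A * D) := by
  refine le_sqrt_of_sq_le ?_
  have := discrim_le_zero (a := A) (b := - (2 * Y)) (c := D) fun r => by
    rcases le_or_gt r 0 with hr | hr
    · nlinarith [mul_nonneg hA (mul_self_nonneg r), mul_nonneg hY (neg_nonneg.2 hr)]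
    · have := mul_le_mul_of_nonneg_left (h r hr) hr.le
      have h2 : r * ((r * A + D / r) / 2) = (A * (r * r) + D) / 2 := by field_simp
      linarith
  rw [discrim] at this
  linarith

/-- For a > 0 the right-hand side is smallest at u = (b / a) (1 - θ) / θ, and the conclusion is its
value there. -/
theorem le_of_forall_le_add_rpow {X a b θ : ℝ} (ha : 0 ≤ a) (hb : 0 < b) (h0 : 0 < θ) (h1 : θ < 1)
    (h : ∀ u : ℝ, 0 < u → X ≤ a * u ^ θ + b * u ^ (θ - 1)) :
    X ≤ a ^ (1 - θ) * b ^ θ * (((1 - θ) / θ) ^ θ / (1 - θ)) := by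
  have h1' : 0 < 1 - θ := by linarith
  -- For a = 0, which is the case D = 0 in the application, no minimiser exists and the infimum 0 is
  -- approached as u → ∞.
  rcases ha.eq_or_lt with rfl | ha
  · rw [zero_rpow h1'.ne']
    have hl : Tendsto (fun u : ℝ => b * u ^ (-(1 - θ))) atTop (nhds (b * 0)) :=
      (tendsto_rpow_neg_atTop h1').const_mul b
    rw [mul_zero] at hl
    have : X ≤ 0 := by
      refine ge_of_tendsto hl ?_
      filter_upwards [eventually_gt_atTop 0] with u hu
      simpa using h u hu
    simpa using this
  · set r := (1 - θ) / θ with hr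
    have hr0 : 0 < r := by positivity
    have hu : 0 < b / a * r := by positivity
    refine (h _ hu).trans_eq ?_
    rw [rpow_sub_one hu.ne', mul_rpow (by positivity) hr0.le, div_rpow hb.le ha.le,
      rpow_sub ha, rpow_one]
    have := (rpow_pos_of_pos ha θ).ne'
    field_simp
    rw [hr]
    field_simp
    ring

/-- The three terms come from (0, ε], (ε, T] and (T, ∞). The number m dominates the weight t^(2β-1)
that Cauchy-Schwarz leaves in the middle; where its maximum sits depends on whether β ≥ 1/2. -/
theorem le_add_sqrt_add_of_integral {β d D ε T m X : ℝ} {v F : ℝ → ℝ} (h0 : 0 < β) (h1 : β < 1)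
    (hε : 0 ≤ ε) (hεT : ε ≤ T) (hT : 0 < T) (hm : 0 ≤ m)
    (hmt : ∀ t ∈ Ioc ε T, t ^ (2 * β - 1) ≤ m)
    (hF : IntegrableOn F (Ioi 0)) (hFD : ∫ t in Ioi 0, F t = D)
    (hv0 : ∀ t, 0 < t → 0 ≤ v t) (hv1 : ∀ t, 0 < t → v t ≤ 2 / t)
    (hv2 : ∀ t, 0 < t → v t ≤ 2 * d / t ^ 2) (hv3 : ∀ t, 0 < t → t * v t ^ 2 ≤ F t)
    (hv : IntegrableOn (fun t => t ^ β * v t) (Ioi 0)) (hX : X ≤ ∫ t in Ioi 0, t ^ β * v t) :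
    X ≤ 2 / β * ε ^ β + √(m * T * D) + 2 * d / (1 - β) * T ^ (β - 1) := by
  have hF0 : ∀ t, 0 < t → 0 ≤ F t := fun t ht =>
    le_trans (by have := ht; positivity) (hv3 t ht)
  have hsub1 : Ioc 0 ε ⊆ Ioi (0 : ℝ) := fun t ht => ht.1
  have hsub2 : Ioc ε T ⊆ Ioi (0 : ℝ) := fun t ht => hε.trans_lt ht.1
  have hsub3 : Ioi T ⊆ Ioi (0 : ℝ) := fun t ht => hT.trans ht
  have hsplit : ∫ t in Ioi 0, t ^ β * v t = (∫ t in Ioc 0 ε, t ^ β * v t) +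
      (∫ t in Ioc ε T, t ^ β * v t) + ∫ t in Ioi T, t ^ β * v t := by
    rw [← setIntegral_union _ measurableSet_Ioc (hv.mono_set hsub1) (hv.mono_set hsub2),
      Ioc_union_Ioc_eq_Ioc hε hεT, ← setIntegral_union _ measurableSet_Ioi
        (hv.mono_set fun t ht => ht.1) (hv.mono_set hsub3), Ioc_union_Ioi_eq_Ioi hT.le]
    · exact Ioc_disjoint_Ioi_same
    · exact Ioc_disjoint_Ioc_of_le le_rfl
  have hD : 0 ≤ D := hFD ▸ setIntegral_nonneg measurableSet_Ioi hF0
  have b1 : ∫ t in Ioc 0 ε, t ^ β * v t ≤ 2 / β * ε ^ β := by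
    have hi : IntervalIntegrable (fun t : ℝ => t ^ (β - 1)) volume 0 ε :=
      intervalIntegral.intervalIntegrable_rpow' (by linarith)
    calc ∫ t in Ioc 0 ε, t ^ β * v t ≤ ∫ t in Ioc 0 ε, 2 * t ^ (β - 1) := by
          refine setIntegral_mono_on (hv.mono_set hsub1)
            (((intervalIntegrable_iff_integrableOn_Ioc_of_le hε).1 hi).const_mul 2)
            measurableSet_Ioc fun t ht => ?_
          rw [rpow_sub_one ht.1.ne']
          refine (mul_le_mul_of_nonneg_left (hv1 t ht.1) (rpow_nonneg ht.1.le _)).trans_eq ?_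
          ring
      _ = 2 / β * ε ^ β := by
          rw [integral_const_mul, ← intervalIntegral.integral_of_le hε,
            integral_rpow (Or.inl (by linarith))]
          simp only [sub_add_cancel, zero_rpow h0.ne', sub_zero]
          ring
  have b3 : ∫ t in Ioi T, t ^ β * v t ≤ 2 * d / (1 - β) * T ^ (β - 1) := by
    have hi := integrableOn_Ioi_rpow_of_lt (a := β - 2) (by linarith) hT
    calc ∫ t in Ioi T, t ^ β * v t ≤ ∫ t in Ioi T, 2 * d * t ^ (β - 2) := by
          refine setIntegral_mono_on (hv.mono_set hsub3) (hi.const_mul _)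
            measurableSet_Ioi fun t ht => ?_
          have ht : 0 < t := hT.trans ht
          rw [rpow_sub ht, rpow_two]
          refine (mul_le_mul_of_nonneg_left (hv2 t ht) (rpow_nonneg ht.le _)).trans_eq ?_
          ring
      _ = _ := by
          have e : β - 1 ≠ 0 := by linarith
          have e' : 1 - β ≠ 0 := by linarith
          rw [integral_const_mul, integral_Ioi_rpow_of_lt (by linarith) hT,
            show β - 2 + 1 = β - 1 by ring]
          field_simp
          ring
  have b2 : ∫ t in Ioc ε T, t ^ β * v t ≤ √(m * T * D) := by
    refine le_sqrt_mul_of_forall_le (setIntegral_nonneg measurableSet_Ioc fun t ht =>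
      mul_nonneg (rpow_nonneg (hsub2 ht).le _) (hv0 t (hsub2 ht))) (by positivity) hD fun r hr => ?_
    have hFi := hF.mono_set hsub2
    have hle : ∫ t in Ioc ε T, F t ≤ D := hFD ▸ setIntegral_mono_set hF
      ((ae_restrict_iff' measurableSet_Ioi).2 (Eventually.of_forall hF0))
      (Eventually.of_forall hsub2)
    calc ∫ t in Ioc ε T, t ^ β * v t ≤ ∫ t in Ioc ε T, (r * m / 2 + F t / (2 * r)) := by
          refine setIntegral_mono_on (hv.mono_set hsub2)
            ((integrableOn_const (by simp)).add (hFi.div_const _)) measurableSet_Ioc fun t ht => ?_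
          have ht0 : 0 < t := hsub2 ht
          -- Half a power of t goes to v, because t v² is what F controls.
          have e1 : t ^ β = t ^ (β - 1 / 2) * √t := by
            rw [sqrt_eq_rpow, ← rpow_add ht0]; ring_nf
          have e2 : t ^ (2 * β - 1) = (t ^ (β - 1 / 2)) ^ 2 := by
            rw [← rpow_natCast, ← rpow_mul ht0.le]; congr 1; push_cast; ring
          have e3 : (t ^ (β - 1 / 2)) ^ 2 ≤ m := e2 ▸ hmt t ht
          have e4 : (√t * v t) ^ 2 ≤ F t := by
            rw [mul_pow, sq_sqrt ht0.le]; exact hv3 t ht0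
          rw [e1, mul_assoc]
          set x := t ^ (β - 1 / 2)
          set y := √t * v t
          have e5 : x * y ≤ (r * x ^ 2 + y ^ 2 / r) / 2 := by
            have : 0 ≤ (r * x - y) ^ 2 / r := by positivity
            have h : (r * x - y) ^ 2 / r = r * x ^ 2 + y ^ 2 / r - 2 * (x * y) := by
              field_simp
              ring
            linarith
          refine e5.trans ?_
          have e6 : y ^ 2 / r ≤ F t / r := div_le_div_of_nonneg_right e4 hr.le
          have e7 := mul_le_mul_of_nonneg_left e3 hr.le
          have e8 : F t / (2 * r) = F t / r / 2 := by field_simp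
          linarith
      _ = r * m / 2 * (T - ε) + (∫ t in Ioc ε T, F t) / (2 * r) := by
          rw [integral_add (integrable_const _) (hFi.div_const _), setIntegral_const, integral_div]
          simp only [volume_real_Ioc_of_le hεT, smul_eq_mul]
          ring
      _ ≤ (r * (m * T) + D / r) / 2 := by
          have e6 := div_le_div_of_nonneg_right hle (by positivity : 0 ≤ 2 * r)
          have e8 : D / (2 * r) = D / r / 2 := by field_simp
          have e9 : r * m / 2 * (T - ε) ≤ r * m / 2 * T :=
            mul_le_mul_of_nonneg_left (by linarith) (by positivity)
          linarith
  linarith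

theorem constU_mul_rpow_le {β d D δ : ℝ} (h0 : 0 < β) (h1 : β < 1) (hd : 0 ≤ d) (hD : 0 ≤ D)
    (hδ : 0 ≤ δ) (h : π / sin (β * π) * δ ≤
      √D ^ (1 - β) * (2 / (1 - β) * ((1 - β) / β + d)) ^ β * (((1 - β) / β) ^ β / (1 - β))) :
    QRE.constU β d * δ ^ (2 / (1 - β)) ≤ D := by
  have h1' : 0 < 1 - β := by linarith
  have hs : 0 < sin (β * π) :=
    sin_pos_of_pos_of_lt_pi (by positivity) (by nlinarith [pi_pos])
  have he : 0 < (1 - β) / β + d := by positivity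
  set e := (1 - β) / β + d with he'
  set K := π * β * (1 - β) / sin (β * π) * e ^ (-β) * 2 ^ (-β) * β ^ (β - 1) with hK
  have hK0 : 0 < K := by positivity
  have hKU : QRE.constU β d = K ^ (2 / (1 - β)) := by
    rw [QRE.constU, ← he', hK, mul_rpow (by positivity) (by positivity),
      mul_rpow (by positivity) (by positivity), mul_rpow (by positivity) (by positivity),
      ← rpow_mul he.le, ← rpow_mul zero_le_two, ← rpow_mul h0.le]
    congr 2
    · congr 2
      · ring
    · ring_nf
    · field_simp
      ring
  have hle : K * δ ≤ √D ^ (1 - β) := by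
    calc K * δ = π / sin (β * π) * δ *
          (β * (1 - β) * e ^ (-β) * 2 ^ (-β) * β ^ (β - 1)) := by rw [hK]; ring
      _ ≤ √D ^ (1 - β) * (2 / (1 - β) * e) ^ β * (((1 - β) / β) ^ β / (1 - β)) *
          (β * (1 - β) * e ^ (-β) * 2 ^ (-β) * β ^ (β - 1)) :=
        mul_le_mul_of_nonneg_right h (by positivity)
      _ = √D ^ (1 - β) := by
        rw [mul_rpow (by positivity) he.le, div_rpow zero_le_two h1'.le, div_rpow h1'.le h0.le,
          rpow_neg he.le, rpow_neg zero_le_two, rpow_sub_one h0.ne']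
        have a1 := (rpow_pos_of_pos he β).ne'
        have a2 := (rpow_pos_of_pos h1' β).ne'
        have a3 := (rpow_pos_of_pos h0 β).ne'
        have a4 := (rpow_pos_of_pos (zero_lt_two (α := ℝ)) β).ne'
        field_simp
  rw [hKU, ← mul_rpow hK0.le hδ]
  refine (rpow_le_rpow (by positivity) hle (by positivity)).trans_eq ?_
  rw [← rpow_mul (sqrt_nonneg _), mul_div_cancel₀ _ h1'.ne', rpow_two, sq_sqrt hD]

theorem constL_mul_rpow_le {β d D δ : ℝ} (h0 : 0 < β) (h1 : β < 1) (hd : 0 ≤ d) (hD : 0 ≤ D)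
    (hδ : 0 ≤ δ) {c : ℝ} (hc : c = 1 - 2 * β + 2 * β ^ 2) (h : π / sin (β * π) * δ ≤
      √D ^ (1 - c) * (2 / β * (1 + β / (1 - β) * d)) ^ c * (((1 - c) / c) ^ c / (1 - c))) :
    QRE.constL β d * δ ^ (1 / (β * (1 - β))) ≤ D := by
  have h1' : 0 < 1 - β := by linarith
  have hs : 0 < sin (β * π) :=
    sin_pos_of_pos_of_lt_pi (by positivity) (by nlinarith [pi_pos])
  have he : 0 < 1 + β / (1 - β) * d := by positivity
  have hc0 : 0 < c := by rw [hc]; nlinarith [sq_nonneg (1 - 2 * β)]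
  -- This identity makes the final exponent 2 / (1 - c) equal to 1 / (β (1 - β)).
  have hc1 : 1 - c = 2 * β * (1 - β) := by rw [hc]; ring
  have hc2 : 2 * (1 - β) = (1 - c) / β := by rw [hc1]; field_simp
  have hc3 : 0 < 1 - c := by rw [hc1]; positivity
  set e := 1 + β / (1 - β) * d with he'
  set K := π * c * β / sin (β * π) * e ^ (-c) * 2 ^ (-c) * (c / (2 * (1 - β))) ^ (c - 1) with hK
  have hK0 : 0 < K := by positivity
  have hKL : QRE.constL β d = K ^ (1 / (β * (1 - β))) := by
    rw [QRE.constL, ← he', ← hc, hK, mul_rpow (by positivity) (by positivity),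
      mul_rpow (by positivity) (by positivity), mul_rpow (by positivity) (by positivity),
      ← rpow_mul he.le, ← rpow_mul zero_le_two, ← rpow_mul (by positivity)]
    congr 2
    · congr 2
      · ring
    · ring_nf
    · rw [← neg_sub 1 c, hc1]
      field_simp
  have hle : K * δ ≤ √D ^ (1 - c) := by
    calc K * δ = π / sin (β * π) * δ *
          (c * β * e ^ (-c) * 2 ^ (-c) * (c / (2 * (1 - β))) ^ (c - 1)) := by rw [hK]; ring
      _ ≤ √D ^ (1 - c) * (2 / β * e) ^ c * (((1 - c) / c) ^ c / (1 - c)) *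
          (c * β * e ^ (-c) * 2 ^ (-c) * (c / (2 * (1 - β))) ^ (c - 1)) :=
        mul_le_mul_of_nonneg_right h (by positivity)
      _ = √D ^ (1 - c) := by
        rw [hc2, mul_rpow (by positivity) he.le, div_rpow zero_le_two h0.le,
          div_rpow hc3.le hc0.le, div_rpow hc0.le (by positivity), div_rpow hc3.le h0.le,
          rpow_neg he.le, rpow_neg zero_le_two, rpow_sub_one hc0.ne', rpow_sub_one hc3.ne',
          rpow_sub_one h0.ne']
        have a1 := (rpow_pos_of_pos he c).ne'
        have a2 := (rpow_pos_of_pos hc3 c).ne'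
        have a3 := (rpow_pos_of_pos h0 c).ne'
        have a4 := (rpow_pos_of_pos (zero_lt_two (α := ℝ)) c).ne'
        have a5 := (rpow_pos_of_pos hc0 c).ne'
        have a6 := hc3.ne'
        generalize √D ^ (1 - c) = Q
        generalize 1 - c = z at *
        field_simp
  rw [hKL, ← mul_rpow hK0.le hδ]
  refine (rpow_le_rpow (by positivity) hle (by positivity)).trans_eq ?_
  rw [← rpow_mul (sqrt_nonneg _), hc1, show 2 * β * (1 - β) * (1 / (β * (1 - β))) = 2 by field_simp,
    rpow_two, sq_sqrt hD]

section Interpolation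

variable {β d D X : ℝ} {v F : ℝ → ℝ}

/-- For β ≥ 1/2 the weight t^(2β-1) is increasing, so ε = 0 is allowed and m = T^(2β-1); only T is
optimised. -/
theorem le_of_integral_of_half_le (h0 : 1 / 2 ≤ β) (h1 : β < 1) (hd : 0 ≤ d)
    (hF : IntegrableOn F (Ioi 0)) (hFD : ∫ t in Ioi 0, F t = D)
    (hv0 : ∀ t, 0 < t → 0 ≤ v t) (hv1 : ∀ t, 0 < t → v t ≤ 2 / t)
    (hv2 : ∀ t, 0 < t → v t ≤ 2 * d / t ^ 2) (hv3 : ∀ t, 0 < t → t * v t ^ 2 ≤ F t)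
    (hv : IntegrableOn (fun t => t ^ β * v t) (Ioi 0)) (hX : X ≤ ∫ t in Ioi 0, t ^ β * v t) :
    X ≤ √D ^ (1 - β) * (2 / (1 - β) * ((1 - β) / β + d)) ^ β * (((1 - β) / β) ^ β / (1 - β)) := by
  have hβ : 0 < β := by linarith
  have h1' : 0 < 1 - β := by linarith
  refine le_of_forall_le_add_rpow (sqrt_nonneg _) (by positivity) hβ h1 fun T hT => ?_
  have hT' := rpow_pos_of_pos hT (2 * β - 1)
  have h := le_add_sqrt_add_of_integral hβ h1 le_rfl hT.le hT hT'.le (fun t ht =>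
    rpow_le_rpow ht.1.le ht.2 (by linarith)) hF hFD hv0 hv1 hv2 hv3 hv hX
  rw [zero_rpow hβ.ne', mul_zero, zero_add] at h
  have e : T ^ (2 * β - 1) * T = (T ^ β) ^ 2 := by
    rw [rpow_sub_one hT.ne', div_mul_cancel₀ _ hT.ne', mul_comm, rpow_mul hT.le, rpow_two]
  rw [e, sqrt_mul (sq_nonneg _), sqrt_sq (rpow_nonneg hT.le _)] at h
  refine h.trans ?_
  rw [mul_comm (T ^ β)]
  gcongr
  rw [show 2 * d / (1 - β) = 2 / (1 - β) * d by ring]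
  gcongr
  -- This summand of the constant is slack, since the part near 0 is empty for ε = 0; it also keeps
  -- the coefficient positive when d = 0.
  have : 0 < (1 - β) / β := by positivity
  linarith

/-- For β < 1/2 the weight t^(2β-1) blows up at 0, so ε > 0 is needed. Both cuts are powers of one
parameter u, chosen so that the two outer terms scale as u^(c-1) and the middle one as u^c. -/
theorem le_of_integral_of_lt_half (h0 : 0 < β) (h1 : β < 1 / 2) (hd : 0 ≤ d)
    (hF : IntegrableOn F (Ioi 0)) (hFD : ∫ t in Ioi 0, F t = D)
    (hv0 : ∀ t, 0 < t → 0 ≤ v t) (hv1 : ∀ t, 0 < t → v t ≤ 2 / t)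
    (hv2 : ∀ t, 0 < t → v t ≤ 2 * d / t ^ 2) (hv3 : ∀ t, 0 < t → t * v t ^ 2 ≤ F t)
    (hv : IntegrableOn (fun t => t ^ β * v t) (Ioi 0)) (hX : X ≤ ∫ t in Ioi 0, t ^ β * v t)
    {c : ℝ} (hc : c = 1 - 2 * β + 2 * β ^ 2) :
    X ≤ √D ^ (1 - c) * (2 / β * (1 + β / (1 - β) * d)) ^ c * (((1 - c) / c) ^ c / (1 - c)) := by
  have h1' : 0 < 1 - β := by linarith
  have hc0 : 0 < c := by rw [hc]; nlinarith [sq_nonneg (1 - 2 * β)]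
  have hc1 : c < 1 := by rw [hc]; nlinarith
  refine le_of_forall_le_add_rpow (sqrt_nonneg _) (by positivity) hc0 hc1 fun u hu => ?_
  set T := u ^ (2 * β) with hTdef
  set ε := u ^ (-(2 * (1 - β))) with hεdef
  have hT : 0 < T := rpow_pos_of_pos hu _
  have hε : 0 < ε := rpow_pos_of_pos hu _
  have hm : 0 < ε ^ (2 * β - 1) := rpow_pos_of_pos hε _
  -- For u < 1 the chosen ε exceeds T. Replacing it by the minimum empties the middle range and can
  -- only decrease the first term.
  have h := le_add_sqrt_add_of_integral h0 (by linarith) (le_min hε.le hT.le) (min_le_right ε T)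
    hT hm.le (fun t ht => ?_) hF hFD hv0 hv1 hv2 hv3 hv hX
  · have e1 : ε ^ (2 * β - 1) * T = (u ^ c) ^ 2 := by
      rw [hεdef, hTdef, ← rpow_mul hu.le, ← rpow_add hu, ← rpow_natCast, ← rpow_mul hu.le, hc]
      congr 1
      push_cast
      ring
    have e2 : ε ^ β = u ^ (c - 1) := by
      rw [hεdef, ← rpow_mul hu.le, hc]
      ring_nf
    have e3 : T ^ (β - 1) = u ^ (c - 1) := by
      rw [hTdef, ← rpow_mul hu.le, hc]
      ring_nf
    rw [e1, e3, sqrt_mul (sq_nonneg _), sqrt_sq (rpow_nonneg hu.le _), mul_comm (u ^ c)] at h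
    have e4 : min ε T ^ β ≤ u ^ (c - 1) :=
      e2 ▸ rpow_le_rpow (le_min hε.le hT.le) (min_le_left _ _) h0.le
    have e5 := mul_le_mul_of_nonneg_left e4 (by positivity : 0 ≤ 2 / β)
    have e6 : 2 / β * (1 + β / (1 - β) * d) * u ^ (c - 1) =
        2 / β * u ^ (c - 1) + 2 * d / (1 - β) * u ^ (c - 1) := by
      field_simp
    linarith
  · have : min ε T = ε := by
      rcases min_choice ε T with h | h
      · exact h
      · exact absurd (h ▸ ht.1) (not_lt.2 ht.2)
    rw [this] at ht
    exact rpow_le_rpow_of_nonpos hε ht.1.le (by linarith)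

end Interpolation

end ScalarIntegrals

noncomputable section

namespace QRE

open Set MeasureTheory Filter Real

variable {n : Type*} [Fintype n] [DecidableEq n] {A B σ ρ : Matrix n n ℂ}

/-! ### Functional calculus in eigenbases, for one matrix and for the pair (left, right)
multiplication. -/

theorem cfc_eq_conj_diagonal (hA : A.IsHermitian) (f : ℝ → ℝ) :
    cfc f A = (hA.eigenvectorUnitary : Matrix n n ℂ) *
      Matrix.diagonal (fun i => (f (hA.eigenvalues i) : ℂ)) *
      star (hA.eigenvectorUnitary : Matrix n n ℂ) := by
  rw [hA.cfc_eq, Matrix.IsHermitian.cfc, Unitary.conjStarAlgAut_apply]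
  rfl

theorem cfc_congr_eigenvalues (hA : A.IsHermitian) {f g : ℝ → ℝ}
    (h : ∀ i, f (hA.eigenvalues i) = g (hA.eigenvalues i)) : cfc f A = cfc g A := by
  simp_rw [cfc_eq_conj_diagonal hA, h]

theorem cfc_mul_cfc (hA : A.IsHermitian) (f g : ℝ → ℝ) :
    cfc f A * cfc g A = cfc (fun x => f x * g x) A := by
  simp_rw [cfc_eq_conj_diagonal hA]
  set U := hA.eigenvectorUnitary
  have hU : star (U : Matrix n n ℂ) * U = 1 := Unitary.coe_star_mul_self U
  calc _ = (U : Matrix n n ℂ) * Matrix.diagonal (fun i => (f (hA.eigenvalues i) : ℂ)) *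
        (star (U : Matrix n n ℂ) * U) * Matrix.diagonal (fun i => (g (hA.eigenvalues i) : ℂ)) *
        star (U : Matrix n n ℂ) := by simp only [Matrix.mul_assoc]
    _ = _ := by
      rw [hU, Matrix.mul_one, Matrix.mul_assoc (U : Matrix n n ℂ), Matrix.diagonal_mul_diagonal]
      push_cast
      rfl

theorem conjTranspose_cfc (f : ℝ → ℝ) (A : Matrix n n ℂ) : (cfc f A)ᴴ = cfc f A :=
  (cfc_predicate f A : IsSelfAdjoint (cfc f A))

theorem eigenvalues_eq_zero_of_cfc_eq_zero (hA : A.IsHermitian) {f : ℝ → ℝ} (h : cfc f A = 0)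
    (i : n) : f (hA.eigenvalues i) = 0 := by
  rw [cfc_eq_conj_diagonal hA] at h
  set U := hA.eigenvectorUnitary
  have hU : star (U : Matrix n n ℂ) * U = 1 := Unitary.coe_star_mul_self U
  have h2 : Matrix.diagonal (fun i => (f (hA.eigenvalues i) : ℂ)) = 0 := by
    calc Matrix.diagonal (fun i => (f (hA.eigenvalues i) : ℂ)) =
        (star (U : Matrix n n ℂ) * U) * Matrix.diagonal (fun i => (f (hA.eigenvalues i) : ℂ)) *
          (star (U : Matrix n n ℂ) * U) := by rw [hU]; simp
      _ = star (U : Matrix n n ℂ) * ((U : Matrix n n ℂ) *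
          Matrix.diagonal (fun i => (f (hA.eigenvalues i) : ℂ)) * star (U : Matrix n n ℂ)) * U := by
        simp only [Matrix.mul_assoc]
      _ = 0 := by rw [h]; simp
  have h3 := congrFun (congrFun h2 i) i
  simpa using h3

theorem posSemidef_cfc (hA : A.IsHermitian) {f : ℝ → ℝ} (h : ∀ i, 0 ≤ f (hA.eigenvalues i)) :
    (cfc f A).PosSemidef := by
  have : cfc f A = (cfc (fun x => √(f x)) A)ᴴ * cfc (fun x => √(f x)) A := by
    rw [conjTranspose_cfc, cfc_mul_cfc hA]
    exact cfc_congr_eigenvalues hA fun i => (mul_self_sqrt (h i)).symm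
  rw [this]
  exact Matrix.posSemidef_conjTranspose_mul_self _

theorem cfc_id_of_isHermitian (hA : A.IsHermitian) : cfc (fun x : ℝ => x) A = A :=
  cfc_id' ℝ A hA.isSelfAdjoint

theorem cfc_one_of_isHermitian (hA : A.IsHermitian) : cfc (fun _ : ℝ => 1) A = 1 :=
  cfc_const_one ℝ A hA.isSelfAdjoint

/-! ### Powers on the support -/

theorem mpow_mul_mpow (hA : A.PosSemidef) (s t : ℝ) : mpow A s * mpow A t = mpow A (s + t) := by
  rw [mpow, mpow, cfc_mul_cfc hA.1, mpow]
  refine cfc_congr_eigenvalues hA.1 fun i => ?_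
  by_cases h : hA.1.eigenvalues i = 0
  · simp [h]
  · simp only [h, if_false]
    rw [rpow_add ((hA.eigenvalues_nonneg i).lt_of_ne' h)]

theorem mpow_one (hA : A.PosSemidef) : mpow A 1 = A := by
  conv_rhs => rw [← cfc_id_of_isHermitian hA.1]
  rw [mpow]
  refine cfc_congr_eigenvalues hA.1 fun i => ?_
  by_cases h : hA.1.eigenvalues i = 0
  · simp [h]
  · simp [h]

theorem mpow_half_mul_self (hA : A.PosSemidef) : mpow A (1 / 2) * mpow A (1 / 2) = A := by
  rw [mpow_mul_mpow hA]; norm_num; exact mpow_one hA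

theorem conjTranspose_mpow (A : Matrix n n ℂ) (s : ℝ) : (mpow A s)ᴴ = mpow A s :=
  conjTranspose_cfc _ _

theorem mpow_eq_cfc_sqrt (hA : A.PosSemidef) : mpow A (1 / 2) = cfc Real.sqrt A := by
  rw [mpow]
  refine cfc_congr_eigenvalues hA.1 fun i => ?_
  by_cases h : hA.1.eigenvalues i = 0
  · simp [h]
  · simp [h, sqrt_eq_rpow]

theorem mpow_neg_one_eq_cfc_inv (hA : A.PosSemidef) : mpow A (-1) = cfc (fun x : ℝ => x⁻¹) A := by
  rw [mpow]
  refine cfc_congr_eigenvalues hA.1 fun i => ?_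
  by_cases h : hA.1.eigenvalues i = 0
  · simp [h]
  · simp [h, rpow_neg_one]

theorem one_sub_mpow_zero (hA : A.PosSemidef) :
    1 - mpow A 0 = cfc (fun x : ℝ => if x = 0 then 1 else 0) A := by
  have h := cfc_one_of_isHermitian hA.1
  rw [← h, mpow, sub_eq_iff_eq_add]
  simp_rw [cfc_eq_conj_diagonal hA.1]
  rw [← Matrix.add_mul, ← Matrix.mul_add, Matrix.diagonal_add]
  congr 3
  ext i
  by_cases h : hA.1.eigenvalues i = 0 <;> simp [h]

theorem mpow_zero_of_posDef (hA : A.PosDef) : mpow A 0 = 1 := by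
  rw [← cfc_one_of_isHermitian hA.1, mpow]
  exact cfc_congr_eigenvalues hA.1 fun i => by simp [(hA.eigenvalues_pos i).ne']

theorem trace_mul_re_nonneg (hA : A.PosSemidef) (hB : B.PosSemidef) : 0 ≤ (A * B).trace.re := by
  have h : (A * B).trace = ((mpow A (1 / 2))ᴴ * B * mpow A (1 / 2)).trace := by
    rw [conjTranspose_mpow, Matrix.trace_mul_comm (_ * B), ← Matrix.mul_assoc,
      mpow_half_mul_self hA]
  rw [h]
  exact (Complex.nonneg_iff.1 (hB.conjTranspose_mul_mul_same _).trace_nonneg).1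

/-- The trace of P A is the squared Hilbert-Schmidt norm of A^(1/2) P. Supports can thus be compared
by traces alone, which the projection onto N preserves when P lies in N. -/
theorem mpow_half_mul_eq_zero_of_trace (hA : A.PosSemidef) {P : Matrix n n ℂ} (hP : Pᴴ = P)
    (hPP : P * P = P) (h : (P * A).trace = 0) : mpow A (1 / 2) * P = 0 := by
  rw [← Matrix.trace_conjTranspose_mul_self_eq_zero_iff, Matrix.conjTranspose_mul, hP,
    conjTranspose_mpow, Matrix.mul_assoc, ← Matrix.mul_assoc (mpow A _), mpow_half_mul_self hA,
    ← Matrix.mul_assoc, Matrix.trace_mul_comm, ← Matrix.mul_assoc, hPP, h]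

theorem mul_eq_zero_of_trace (hA : A.PosSemidef) {P : Matrix n n ℂ} (hP : Pᴴ = P)
    (hPP : P * P = P) (h : (P * A).trace = 0) : A * P = 0 := by
  rw [← mpow_half_mul_self hA, Matrix.mul_assoc, mpow_half_mul_eq_zero_of_trace hA hP hPP h,
    Matrix.mul_zero]

/-! ### Hilbert-Schmidt norm -/

theorem hsNorm_sq {m : Type*} [Fintype m] (X : Matrix m m ℂ) : hsNorm X ^ 2 = (Xᴴ * X).trace.re := by
  rw [← inner_toHS, hsNorm, ← inner_self_eq_norm_sq (𝕜 := ℂ)]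
  rfl

theorem hsNorm_nonneg {m : Type*} [Fintype m] (X : Matrix m m ℂ) : 0 ≤ hsNorm X := norm_nonneg _

/-! ### Joint functional calculus of left and right multiplication -/

/-- `∑ h(s, p) Q_s P_p` where `σ = ∑ s Q_s` and `ρ = ∑ p P_p` are the spectral decompositions. This is
the image of `1` under the function `h` of the commuting operators `X ↦ σ X` and `X ↦ X ρ`. -/
def jointCfc (hσ : σ.IsHermitian) (hρ : ρ.IsHermitian) (h : ℝ → ℝ → ℝ) : Matrix n n ℂ :=
  (hσ.eigenvectorUnitary : Matrix n n ℂ) *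
    Matrix.of (fun j i => (h (hσ.eigenvalues j) (hρ.eigenvalues i) : ℂ) *
      (star (hσ.eigenvectorUnitary : Matrix n n ℂ) * (hρ.eigenvectorUnitary : Matrix n n ℂ)) j i) *
    star (hρ.eigenvectorUnitary : Matrix n n ℂ)

/-- Squared moduli of the scalar products of the eigenvectors of `σ` and `ρ`. -/
def overlap (hσ : σ.IsHermitian) (hρ : ρ.IsHermitian) (j i : n) : ℝ :=
  Complex.normSq
    ((star (hσ.eigenvectorUnitary : Matrix n n ℂ) * (hρ.eigenvectorUnitary : Matrix n n ℂ)) j i)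

variable (hσ : σ.IsHermitian) (hρ : ρ.IsHermitian)

theorem overlap_nonneg (j i : n) : 0 ≤ overlap hσ hρ j i := Complex.normSq_nonneg _

theorem jointCfc_congr {h k : ℝ → ℝ → ℝ}
    (hk : ∀ j i, h (hσ.eigenvalues j) (hρ.eigenvalues i) = k (hσ.eigenvalues j) (hρ.eigenvalues i)) :
    jointCfc hσ hρ h = jointCfc hσ hρ k := by
  simp only [jointCfc, hk]

theorem cfc_mul_jointCfc_mul_cfc (f g : ℝ → ℝ) (h : ℝ → ℝ → ℝ) :
    cfc f σ * jointCfc hσ hρ h * cfc g ρ = jointCfc hσ hρ fun x y => f x * h x y * g y := by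
  rw [cfc_eq_conj_diagonal hσ, cfc_eq_conj_diagonal hρ, jointCfc, jointCfc]
  set V := hσ.eigenvectorUnitary
  set U := hρ.eigenvectorUnitary
  have hU : star (U : Matrix n n ℂ) * U = 1 := Unitary.coe_star_mul_self U
  have hV : star (V : Matrix n n ℂ) * V = 1 := Unitary.coe_star_mul_self V
  set W := star (V : Matrix n n ℂ) * U
  set H : Matrix n n ℂ :=
    Matrix.of fun j i => (h (hσ.eigenvalues j) (hρ.eigenvalues i) : ℂ) * W j i
  set Df : Matrix n n ℂ := Matrix.diagonal fun i => (f (hσ.eigenvalues i) : ℂ)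
  set Dg : Matrix n n ℂ := Matrix.diagonal fun i => (g (hρ.eigenvalues i) : ℂ)
  calc _ = (V : Matrix n n ℂ) * (Df * (star (V : Matrix n n ℂ) * V) * H *
        (star (U : Matrix n n ℂ) * U) * Dg) * star (U : Matrix n n ℂ) := by
        simp only [Matrix.mul_assoc]
    _ = _ := by
      rw [hU, hV, Matrix.mul_one, Matrix.mul_one]
      congr 2
      ext j i
      simp only [Df, Dg, H, Matrix.mul_diagonal, Matrix.diagonal_mul, Matrix.of_apply]
      push_cast
      ring

theorem jointCfc_one : jointCfc hσ hρ (fun _ _ => 1) = 1 := by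
  rw [jointCfc]
  have : (Matrix.of fun j i => ((1 : ℝ) : ℂ) * (star (hσ.eigenvectorUnitary : Matrix n n ℂ) *
      (hρ.eigenvectorUnitary : Matrix n n ℂ)) j i) =
      star (hσ.eigenvectorUnitary : Matrix n n ℂ) * (hρ.eigenvectorUnitary : Matrix n n ℂ) := by
    ext j i; simp
  have hU := Unitary.coe_mul_star_self hρ.eigenvectorUnitary
  have hV := Unitary.coe_mul_star_self hσ.eigenvectorUnitary
  rw [Unitary.coe_star] at hU hV
  rw [this, ← Matrix.mul_assoc, hV, Matrix.one_mul, hU]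

theorem cfc_mul_cfc_eq_jointCfc (f g : ℝ → ℝ) :
    cfc f σ * cfc g ρ = jointCfc hσ hρ fun x y => f x * g y := by
  have h := cfc_mul_jointCfc_mul_cfc hσ hρ f g fun _ _ => 1
  rw [jointCfc_one, Matrix.mul_one] at h
  simpa using h

theorem cfc_left_eq_jointCfc (f : ℝ → ℝ) : cfc f σ = jointCfc hσ hρ fun x _ => f x := by
  have h := cfc_mul_cfc_eq_jointCfc hσ hρ f fun _ => 1
  rw [cfc_one_of_isHermitian hρ, Matrix.mul_one] at h
  simpa using h

theorem cfc_right_eq_jointCfc (g : ℝ → ℝ) : cfc g ρ = jointCfc hσ hρ fun _ y => g y := by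
  have h := cfc_mul_cfc_eq_jointCfc hσ hρ (fun _ => 1) g
  rw [cfc_one_of_isHermitian hσ, Matrix.one_mul] at h
  simpa using h

/-- The matrix units between the eigenbases of σ and ρ are orthonormal. Resolvent forms and
entropies thereby become scalar sums with the weights `overlap`. -/
theorem trace_conjTranspose_jointCfc_mul_jointCfc (h k : ℝ → ℝ → ℝ) :
    ((jointCfc hσ hρ h)ᴴ * jointCfc hσ hρ k).trace =
      ((∑ i, ∑ j, h (hσ.eigenvalues j) (hρ.eigenvalues i) *
        k (hσ.eigenvalues j) (hρ.eigenvalues i) * overlap hσ hρ j i : ℝ) : ℂ) := by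
  rw [jointCfc, jointCfc]
  simp only [overlap]
  set V := hσ.eigenvectorUnitary
  set U := hρ.eigenvectorUnitary
  have hU : star (U : Matrix n n ℂ) * U = 1 := Unitary.coe_star_mul_self U
  have hV : star (V : Matrix n n ℂ) * V = 1 := Unitary.coe_star_mul_self V
  set W := star (V : Matrix n n ℂ) * U
  set H : Matrix n n ℂ :=
    Matrix.of fun j i => (h (hσ.eigenvalues j) (hρ.eigenvalues i) : ℂ) * W j i with hH
  set K : Matrix n n ℂ :=
    Matrix.of fun j i => (k (hσ.eigenvalues j) (hρ.eigenvalues i) : ℂ) * W j i with hK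
  rw [Matrix.conjTranspose_mul, Matrix.conjTranspose_mul, ← Matrix.star_eq_conjTranspose (star _),
    star_star, Matrix.mul_assoc, Matrix.trace_mul_comm]
  calc _ = (Hᴴ * (star (V : Matrix n n ℂ) * V) * K * (star (U : Matrix n n ℂ) * U)).trace := by
        simp only [Matrix.mul_assoc, Matrix.star_eq_conjTranspose]
    _ = _ := by
      rw [hU, hV, Matrix.mul_one, Matrix.mul_one, Matrix.trace]
      simp only [Matrix.diag, Matrix.mul_apply, Matrix.conjTranspose_apply, hH, hK, Matrix.of_apply,
        star_mul', Complex.ofReal_sum, Complex.ofReal_mul, Complex.normSq_eq_conj_mul_self,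
        RCLike.star_def, Complex.conj_ofReal]
      refine Finset.sum_congr rfl fun i _ => Finset.sum_congr rfl fun j _ => ?_
      ring

theorem hsNorm_jointCfc_sq (h : ℝ → ℝ → ℝ) :
    hsNorm (jointCfc hσ hρ h) ^ 2 = ∑ i, ∑ j, h (hσ.eigenvalues j) (hρ.eigenvalues i) ^ 2 *
      overlap hσ hρ j i := by
  rw [hsNorm_sq, trace_conjTranspose_jointCfc_mul_jointCfc, Complex.ofReal_re]
  simp only [sq]

theorem hsNorm_jointCfc_le {h k : ℝ → ℝ → ℝ}
    (hk : ∀ j i, |h (hσ.eigenvalues j) (hρ.eigenvalues i)| ≤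
      |k (hσ.eigenvalues j) (hρ.eigenvalues i)|) :
    hsNorm (jointCfc hσ hρ h) ≤ hsNorm (jointCfc hσ hρ k) := by
  refine (sq_le_sq₀ (hsNorm_nonneg _) (hsNorm_nonneg _)).1 ?_
  rw [hsNorm_jointCfc_sq, hsNorm_jointCfc_sq]
  exact Finset.sum_le_sum fun i _ => Finset.sum_le_sum fun j _ =>
    mul_le_mul_of_nonneg_right (sq_le_sq.2 (hk j i)) (overlap_nonneg ..)

theorem jointCfc_sub (h k : ℝ → ℝ → ℝ) :
    jointCfc hσ hρ h - jointCfc hσ hρ k = jointCfc hσ hρ fun x y => h x y - k x y := by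
  simp only [jointCfc]
  rw [← Matrix.sub_mul, ← Matrix.mul_sub]
  congr 2
  ext j i
  simp [sub_mul]

theorem jointCfc_add (h k : ℝ → ℝ → ℝ) :
    jointCfc hσ hρ h + jointCfc hσ hρ k = jointCfc hσ hρ fun x y => h x y + k x y := by
  simp only [jointCfc]
  rw [← Matrix.add_mul, ← Matrix.mul_add]
  congr 2
  ext j i
  simp [add_mul]

theorem smul_jointCfc (c : ℝ) (h : ℝ → ℝ → ℝ) :
    (c : ℂ) • jointCfc hσ hρ h = jointCfc hσ hρ fun x y => c * h x y := by
  simp only [jointCfc]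
  rw [← Matrix.smul_mul, ← Matrix.mul_smul]
  congr 2
  ext j i
  simp [mul_assoc]

theorem jointCfc_sum_mul {ι : Type*} (s : Finset ι) (c : ι → ℝ) (h : ι → ℝ → ℝ → ℝ) :
    jointCfc hσ hρ (fun x y => ∑ a ∈ s, c a * h a x y) =
      ∑ a ∈ s, (c a : ℂ) • jointCfc hσ hρ (h a) := by
  classical
  induction s using Finset.induction_on with
  | empty =>
    have := smul_jointCfc hσ hρ 0 fun _ _ => 0
    simpa using this.symm
  | insert a s ha ih =>
    simp only [Finset.sum_insert ha]
    rw [← ih, smul_jointCfc, jointCfc_add]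

-- Grouping by distinct eigenvalues replaces eigenvectors by spectral projections, which, unlike the
-- eigenvector matrices, belong to any algebra containing σ and ρ.
open Classical in
theorem jointCfc_eq_sum (h : ℝ → ℝ → ℝ) :
    jointCfc hσ hρ h = ∑ a ∈ Finset.univ.image hσ.eigenvalues ×ˢ Finset.univ.image hρ.eigenvalues,
      (h a.1 a.2 : ℂ) • (cfc (fun x => if x = a.1 then 1 else 0) σ *
        cfc (fun y => if y = a.2 then 1 else 0) ρ) := by
  simp only [cfc_mul_cfc_eq_jointCfc hσ hρ]
  rw [← jointCfc_sum_mul hσ hρ _ (fun a : ℝ × ℝ => h a.1 a.2)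
    (fun a x y => (if x = a.1 then 1 else 0) * (if y = a.2 then 1 else 0))]
  refine jointCfc_congr hσ hρ fun j i => ?_
  rw [Finset.sum_eq_single (hσ.eigenvalues j, hρ.eigenvalues i)]
  · simp
  · rintro ⟨a, b⟩ - hne
    rcases eq_or_ne (hσ.eigenvalues j) a with rfl | h1
    · rcases eq_or_ne (hρ.eigenvalues i) b with rfl | h2
      · exact absurd rfl hne
      · simp [h2]
    · simp [h1]
  · intro hn
    simp at hn

theorem cfc_mem_starSubalgebra {N : StarSubalgebra ℂ (Matrix n n ℂ)} (hA : A ∈ N) (f : ℝ → ℝ) :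
    cfc f A ∈ N := by
  have : IsClosed (N : Set (Matrix n n ℂ)) :=
    N.toSubalgebra.toSubmodule.closed_of_finiteDimensional
  exact cfc_mem (𝕜' := ℂ) f hA

theorem jointCfc_mem {N : StarSubalgebra ℂ (Matrix n n ℂ)} (hσN : σ ∈ N) (hρN : ρ ∈ N)
    (h : ℝ → ℝ → ℝ) : jointCfc hσ hρ h ∈ N := by
  classical
  rw [jointCfc_eq_sum]
  exact sum_mem fun a _ => N.smul_mem
    (mul_mem (cfc_mem_starSubalgebra hσN _) (cfc_mem_starSubalgebra hρN _)) _

/-- The matrix unit from the i-th eigenvector of ρ to the j-th eigenvector of σ is an eigenvector of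
the modular operator with this eigenvalue. -/
theorem mul_inv_eigenvalues_le_hsOpNorm (hσ : σ.PosSemidef) (hρ : ρ.PosSemidef) (j i : n) :
    hσ.1.eigenvalues j * (hρ.1.eigenvalues i)⁻¹ ≤ hsOpNorm (relModular σ ρ) := by
  set V := hσ.1.eigenvectorUnitary with hVd
  set U := hρ.1.eigenvectorUnitary with hUd
  have hU : star (U : Matrix n n ℂ) * U = 1 := Unitary.coe_star_mul_self U
  have hV : star (V : Matrix n n ℂ) * V = 1 := Unitary.coe_star_mul_self V
  set E := Matrix.single j i (1 : ℂ)
  set X := (V : Matrix n n ℂ) * E * star (U : Matrix n n ℂ) with hX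
  have hX0 : X ≠ 0 := by
    intro h0
    have : E = star (V : Matrix n n ℂ) * X * U := by
      calc E = (star (V : Matrix n n ℂ) * V) * E * (star (U : Matrix n n ℂ) * U) := by
            rw [hU, hV]; simp
        _ = _ := by rw [hX]; simp only [Matrix.mul_assoc]
    rw [h0, Matrix.mul_zero, Matrix.zero_mul] at this
    have h2 := congrFun (congrFun this j) i
    simp [E] at h2
  set r := hσ.1.eigenvalues j * (hρ.1.eigenvalues i)⁻¹ with hr
  have hr0 : 0 ≤ r := mul_nonneg (hσ.eigenvalues_nonneg j) (inv_nonneg.2 (hρ.eigenvalues_nonneg i))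
  have hLX : relModular σ ρ X = (r : ℂ) • X := by
    have h1 : relModular σ ρ X = cfc (fun x : ℝ => x) σ * X * cfc (fun x : ℝ => x⁻¹) ρ := by
      rw [cfc_id_of_isHermitian hσ.1, ← mpow_neg_one_eq_cfc_inv hρ, Matrix.mul_assoc]
      rfl
    rw [h1, cfc_eq_conj_diagonal hσ.1, cfc_eq_conj_diagonal hρ.1, ← hVd, ← hUd, hX]
    set Df : Matrix n n ℂ := Matrix.diagonal fun i => (hσ.1.eigenvalues i : ℂ)
    set Dg : Matrix n n ℂ := Matrix.diagonal fun i => (((hρ.1.eigenvalues i)⁻¹ : ℝ) : ℂ)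
    calc _ = (V : Matrix n n ℂ) * (Df * (star (V : Matrix n n ℂ) * V) * E *
          (star (U : Matrix n n ℂ) * U) * Dg) * star (U : Matrix n n ℂ) := by
          simp only [Matrix.mul_assoc]
      _ = _ := by
        rw [hU, hV, Matrix.mul_one, Matrix.mul_one, ← Matrix.smul_mul, ← Matrix.mul_smul]
        congr 2
        ext a b
        simp only [Df, Dg, E, Matrix.mul_diagonal, Matrix.diagonal_mul, Matrix.smul_apply,
          Matrix.single_apply, hr]
        by_cases hab : j = a ∧ i = b
        · obtain ⟨rfl, rfl⟩ := hab
          simp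
        · simp [hab]
  have hnX : 0 < ‖toHS X‖ := norm_pos_iff.2 (by simpa using hX0)
  have hle := (LinearMap.toContinuousLinearMap
    (toHS.toLinearMap ∘ₗ relModular σ ρ ∘ₗ toHS.symm.toLinearMap)).le_opNorm (toHS X)
  have hLX' : (LinearMap.toContinuousLinearMap
    (toHS.toLinearMap ∘ₗ relModular σ ρ ∘ₗ toHS.symm.toLinearMap)) (toHS X) =
      (r : ℂ) • toHS X := by
    rw [← map_smul, ← hLX]
    simp
  rw [hLX', norm_smul, Complex.norm_real, norm_of_nonneg hr0] at hle
  exact le_of_mul_le_mul_right hle hnX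

end QRE
end

noncomputable section

namespace QRE

open Set MeasureTheory Filter Real

variable {n : Type*} [Fintype n] [DecidableEq n] {N : StarSubalgebra ℂ (Matrix n n ℂ)}
  {A σ ρ : Matrix n n ℂ}

/-! ### The conditional expectation: positivity, supports, spectral bounds. -/

theorem trace_mul_condExp (N : StarSubalgebra ℂ (Matrix n n ℂ)) (X : Matrix n n ℂ)
    {Z : Matrix n n ℂ} (hZ : Z ∈ N) : (Z * condExp N X).trace = (Z * X).trace := by
  have h := trace_condExp N X Zᴴ (star_mem hZ)
  rw [Matrix.conjTranspose_conjTranspose, Matrix.mul_sub, Matrix.trace_sub, sub_eq_zero] at h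
  exact h.symm

theorem eq_condExp {X Y : Matrix n n ℂ} (hY : Y ∈ N)
    (h : ∀ Z ∈ N, (Z * Y).trace = (Z * X).trace) : Y = condExp N X := by
  rw [← sub_eq_zero, ← Matrix.trace_conjTranspose_mul_self_eq_zero_iff, Matrix.mul_sub,
    Matrix.trace_sub]
  have hm : (Y - condExp N X)ᴴ ∈ N := star_mem (sub_mem hY (condExp_mem N X))
  rw [h _ hm, trace_mul_condExp N X hm, sub_self]

theorem condExp_sub (X Y : Matrix n n ℂ) : condExp N (X - Y) = condExp N X - condExp N Y := by
  simp [condExp]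

theorem condExp_smul (c : ℂ) (X : Matrix n n ℂ) : condExp N (c • X) = c • condExp N X := by
  simp [condExp]

theorem condExp_one : condExp N 1 = 1 := (eq_condExp N.one_mem fun _ _ => rfl).symm

theorem condExp_conjTranspose (X : Matrix n n ℂ) : condExp N Xᴴ = (condExp N X)ᴴ := by
  refine (eq_condExp (star_mem (condExp_mem N X)) fun Z hZ => ?_).symm
  have h := trace_mul_condExp N X (Z := Zᴴ) (star_mem hZ)
  have h2 := congrArg star h
  rw [← Matrix.trace_conjTranspose, ← Matrix.trace_conjTranspose, Matrix.conjTranspose_mul,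
    Matrix.conjTranspose_mul, Matrix.conjTranspose_conjTranspose, Matrix.trace_mul_comm,
    Matrix.trace_mul_comm Xᴴ] at h2
  exact h2

theorem trace_condExp_eq (X : Matrix n n ℂ) : (condExp N X).trace = X.trace := by
  simpa using trace_mul_condExp N X N.one_mem

theorem isHermitian_condExp (hA : A.IsHermitian) : (condExp N A).IsHermitian := by
  rw [Matrix.IsHermitian, ← condExp_conjTranspose, hA.eq]

/-- Let B be the negative part of E(A); it lies in N. Then Tr(B E(A)) = Tr(B A) ≥ 0, whereas B E(A)
= -B², so B = 0. -/
theorem posSemidef_condExp (hA : A.PosSemidef) : (condExp N A).PosSemidef := by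
  have hE : (condExp N A).IsHermitian := isHermitian_condExp hA.1
  rw [hE.posSemidef_iff_eigenvalues_nonneg]
  set B := cfc (fun x : ℝ => max (-x) 0) (condExp N A) with hB
  have hBpos : B.PosSemidef := posSemidef_cfc hE fun _ => le_max_right _ _
  have hBN : B ∈ N := cfc_mem_starSubalgebra (condExp_mem N A) _
  have h1 : 0 ≤ (B * condExp N A).trace.re := by
    rw [trace_mul_condExp N A hBN]
    exact trace_mul_re_nonneg hBpos hA
  have h2 : B * condExp N A = - (Bᴴ * B) := by
    rw [hB, conjTranspose_cfc, cfc_mul_cfc hE]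
    nth_rewrite 2 [← cfc_id_of_isHermitian hE]
    rw [cfc_mul_cfc hE, ← cfc_neg]
    refine cfc_congr_eigenvalues hE fun i => ?_
    rcases le_total (-(hE.eigenvalues i)) 0 with h | h
    · simp [max_eq_right h]
    · simp [max_eq_left h]
  rw [h2, Matrix.trace_neg, Complex.neg_re, ← hsNorm_sq] at h1
  have h3 : hsNorm B = 0 := by
    have := sq_nonneg (hsNorm B)
    exact pow_eq_zero_iff two_ne_zero |>.1 (by linarith)
  have h4 : B = 0 := by
    rw [hsNorm, norm_eq_zero] at h3
    simpa using h3
  intro i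
  have h5 := eigenvalues_eq_zero_of_cfc_eq_zero hE h4 i
  simp only [max_eq_right_iff] at h5
  simpa using h5

theorem IsDensity.condExp (hρ : IsDensity ρ) : IsDensity (condExp N ρ) :=
  ⟨posSemidef_condExp hρ.1, by rw [trace_condExp_eq, hρ.2]⟩

theorem conjTranspose_one_sub_mpow_zero (A : Matrix n n ℂ) : (1 - mpow A 0)ᴴ = 1 - mpow A 0 := by
  rw [Matrix.conjTranspose_sub, conjTranspose_mpow, Matrix.conjTranspose_one]

theorem one_sub_mpow_zero_mul_self (hA : A.PosSemidef) :
    (1 - mpow A 0) * (1 - mpow A 0) = 1 - mpow A 0 := by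
  have := mpow_mul_mpow hA 0 0
  rw [add_zero] at this
  simp [Matrix.sub_mul, Matrix.mul_sub, this]

theorem one_sub_mpow_zero_mul (hA : A.PosSemidef) : (1 - mpow A 0) * A = 0 := by
  have := mpow_mul_mpow hA 0 1
  rw [zero_add, mpow_one hA] at this
  rw [Matrix.sub_mul, this]
  simp

theorem one_sub_mpow_zero_mem (hA : A ∈ N) : 1 - mpow A 0 ∈ N :=
  sub_mem N.one_mem (cfc_mem_starSubalgebra hA _)

/-- The kernel projection P of E(A) lies in N, so Tr(P A) = Tr(P E(A)) = 0: the support of A sits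
inside that of E(A). -/
theorem mpow_half_mul_one_sub_mpow_condExp (hA : A.PosSemidef) :
    mpow A (1 / 2) * (1 - mpow (condExp N A) 0) = 0 := by
  have hE := posSemidef_condExp (N := N) hA
  refine mpow_half_mul_eq_zero_of_trace hA (conjTranspose_one_sub_mpow_zero _)
    (one_sub_mpow_zero_mul_self hE) ?_
  rw [← trace_mul_condExp N A (one_sub_mpow_zero_mem (condExp_mem N A)), one_sub_mpow_zero_mul hE,
    Matrix.trace_zero]

theorem mpow_condExp_zero_mul_mpow_half (hA : A.PosSemidef) :
    mpow (condExp N A) 0 * mpow A (1 / 2) = mpow A (1 / 2) := by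
  have h := congrArg Matrix.conjTranspose (mpow_half_mul_one_sub_mpow_condExp (N := N) hA)
  rw [Matrix.conjTranspose_mul, conjTranspose_one_sub_mpow_zero, conjTranspose_mpow,
    Matrix.sub_mul, Matrix.one_mul, Matrix.conjTranspose_zero, sub_eq_zero] at h
  exact h.symm

theorem mul_eq_zero_of_ker_le {X : Matrix n n ℂ}
    (h : LinearMap.ker σ.mulVecLin ≤ LinearMap.ker ρ.mulVecLin) (hX : σ * X = 0) : ρ * X = 0 := by
  refine Matrix.ext_of_mulVec_single fun i => ?_
  have h1 : X.mulVec (Pi.single i 1) ∈ LinearMap.ker σ.mulVecLin := by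
    rw [LinearMap.mem_ker, Matrix.mulVecLin_apply, Matrix.mulVec_mulVec, hX, Matrix.zero_mulVec]
  have h2 := h h1
  rw [LinearMap.mem_ker, Matrix.mulVecLin_apply, Matrix.mulVec_mulVec] at h2
  rw [h2, Matrix.zero_mulVec]

/-- Let P be the kernel projection of σ_N. Trace preservation gives σ P = 0, the hypothesis gives ρ
P = 0, and trace preservation again gives ρ_N P = 0. -/
theorem ker_condExp_le (hρ : ρ.PosSemidef) (hσ : σ.PosSemidef)
    (h : LinearMap.ker σ.mulVecLin ≤ LinearMap.ker ρ.mulVecLin) :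
    LinearMap.ker (condExp N σ).mulVecLin ≤ LinearMap.ker (condExp N ρ).mulVecLin := by
  set P := 1 - mpow (condExp N σ) 0 with hP
  have hE := posSemidef_condExp (N := N) hσ
  have hPN : P ∈ N := one_sub_mpow_zero_mem (condExp_mem N σ)
  have hPs : Pᴴ = P := conjTranspose_one_sub_mpow_zero _
  have hPP : P * P = P := one_sub_mpow_zero_mul_self hE
  have h1 : σ * P = 0 := by
    refine mul_eq_zero_of_trace hσ hPs hPP ?_
    rw [← trace_mul_condExp N σ hPN, one_sub_mpow_zero_mul hE, Matrix.trace_zero]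
  have h2 : ρ * P = 0 := mul_eq_zero_of_ker_le h h1
  have h3 : condExp N ρ * P = 0 := by
    refine mul_eq_zero_of_trace (posSemidef_condExp hρ) hPs hPP ?_
    rw [trace_mul_condExp N ρ hPN, Matrix.trace_mul_comm, h2, Matrix.trace_zero]
  intro v hv
  rw [LinearMap.mem_ker, Matrix.mulVecLin_apply] at hv ⊢
  have h4 : mpow (condExp N σ) 0 = mpow (condExp N σ) (-1) * condExp N σ := by
    rw [← congrArg (mpow (condExp N σ) (-1) * ·) (mpow_one hE), mpow_mul_mpow hE]
    norm_num
  have h5 : P.mulVec v = v := by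
    rw [hP, Matrix.sub_mulVec, h4, ← Matrix.mulVec_mulVec, hv]
    simp
  rw [← h5, Matrix.mulVec_mulVec, h3, Matrix.zero_mulVec]

theorem smul_one_sub_eq_cfc (hA : A.IsHermitian) (c : ℝ) :
    (c : ℂ) • (1 : Matrix n n ℂ) - A = cfc (fun x => c - x) A := by
  rw [cfc_sub (fun _ => c) (fun x => x) A (Matrix.finite_real_spectrum.continuousOn _)
    (Matrix.finite_real_spectrum.continuousOn _), cfc_id_of_isHermitian hA,
    cfc_const c A hA.isSelfAdjoint]
  congr 1
  rw [Algebra.algebraMap_eq_smul_one]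
  ext i j
  simp [Matrix.one_apply]

theorem eigenvectorBasis_dotProduct (hA : A.IsHermitian) (c : ℝ) (i : n) :
    (star ⇑(hA.eigenvectorBasis i) ⬝ᵥ
      ((c : ℂ) • (1 : Matrix n n ℂ) - A) *ᵥ ⇑(hA.eigenvectorBasis i)).re =
      c - hA.eigenvalues i := by
  have h1 : star ⇑(hA.eigenvectorBasis i) ⬝ᵥ ⇑(hA.eigenvectorBasis i) = 1 := by
    have := hA.eigenvectorBasis.orthonormal.1 i
    have h2 := inner_self_eq_norm_sq_to_K (𝕜 := ℂ) (hA.eigenvectorBasis i)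
    rw [this, EuclideanSpace.inner_eq_star_dotProduct, dotProduct_comm] at h2
    simpa using h2
  rw [hA.eigenvalues_eq, Matrix.sub_mulVec, dotProduct_sub, Matrix.smul_mulVec, Matrix.one_mulVec,
    dotProduct_smul, h1]
  simp

/-- The expectation is positive and unital, so c - A ≥ 0 implies c - E(A) ≥ 0. -/
theorem eigenvalues_condExp_le (hA : A.IsHermitian) (hE : (condExp N A).IsHermitian) {c : ℝ}
    (h : ∀ i, hA.eigenvalues i ≤ c) (i : n) : hE.eigenvalues i ≤ c := by
  have h1 : ((c : ℂ) • (1 : Matrix n n ℂ) - A).PosSemidef := by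
    rw [smul_one_sub_eq_cfc hA]
    exact posSemidef_cfc hA fun i => sub_nonneg.2 (h i)
  have h2 := posSemidef_condExp (N := N) h1
  rw [condExp_sub, condExp_smul, condExp_one] at h2
  have h3 := (Complex.nonneg_iff.1 (h2.dotProduct_mulVec_nonneg (hE.eigenvectorBasis i))).1
  rw [eigenvectorBasis_dotProduct hE] at h3
  linarith

theorem le_eigenvalues_condExp (hA : A.IsHermitian) (hE : (condExp N A).IsHermitian) {c : ℝ}
    (h : ∀ i, c ≤ hA.eigenvalues i) (i : n) : c ≤ hE.eigenvalues i := by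
  have h1 : (-((c : ℂ) • (1 : Matrix n n ℂ) - A)).PosSemidef := by
    rw [smul_one_sub_eq_cfc hA, ← cfc_neg]
    exact posSemidef_cfc hA fun i => by linarith [h i]
  have h2 := posSemidef_condExp (N := N) h1
  rw [neg_sub, condExp_sub, condExp_smul, condExp_one, ← neg_sub] at h2
  have h3 := (Complex.nonneg_iff.1 (h2.dotProduct_mulVec_nonneg (hE.eigenvectorBasis i))).1
  rw [Matrix.neg_mulVec, dotProduct_neg, Complex.neg_re, eigenvectorBasis_dotProduct hE] at h3
  linarith

/-- The expectation keeps spectra between their extremes, and the largest eigenvalue of σ over the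
smallest of ρ is itself an eigenvalue of the modular operator. For singular ρ the least nonzero
eigenvalue of ρ need not bound those of ρ_N, hence the maximum in part (b). -/
theorem mul_inv_eigenvalues_condExp_le (hσ : σ.PosSemidef) (hρ : ρ.PosDef)
    (hσE : (condExp N σ).IsHermitian) (hρE : (condExp N ρ).IsHermitian) (j i : n) :
    hσE.eigenvalues j * (hρE.eigenvalues i)⁻¹ ≤ hsOpNorm (relModular σ ρ) := by
  have : Nonempty n := ⟨j⟩
  obtain ⟨j₀, hj₀⟩ := Finite.exists_max hσ.1.eigenvalues
  obtain ⟨i₀, hi₀⟩ := Finite.exists_min hρ.1.eigenvalues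
  refine le_trans ?_ (mul_inv_eigenvalues_le_hsOpNorm hσ hρ.posSemidef j₀ i₀)
  have hp := hρ.eigenvalues_pos i₀
  exact mul_le_mul (eigenvalues_condExp_le hσ.1 hσE hj₀ j)
    (inv_anti₀ hp (le_eigenvalues_condExp hρ.1 hρE hi₀ i))
    (inv_nonneg.2 (hp.le.trans (le_eigenvalues_condExp hρ.1 hρE hi₀ i)))
    (hσ.eigenvalues_nonneg j₀)

end QRE
end

noncomputable section

namespace QRE

open Set MeasureTheory Filter Real

variable {n : Type*} [Fintype n] [DecidableEq n] {N : StarSubalgebra ℂ (Matrix n n ℂ)}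
  {A σ ρ : Matrix n n ℂ}

/-! ### Resolvents of the relative modular operator -/

/-! ### Modular resolvents and the partial isometry U. -/

/-- `(t + Δ)⁻¹ ρ^(1/2)`, where `Δ` is the relative modular operator `X ↦ σ X ρ⁻¹`. -/
def modularResolvent (hσ : σ.IsHermitian) (hρ : ρ.IsHermitian) (t : ℝ) : Matrix n n ℂ :=
  jointCfc hσ hρ fun x y => √y * (t + x * y⁻¹)⁻¹

theorem eigenvalues_mul_inv_nonneg (hσ : σ.PosSemidef) (hρ : ρ.PosSemidef) (j i : n) :
    0 ≤ hσ.1.eigenvalues j * (hρ.1.eigenvalues i)⁻¹ :=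
  mul_nonneg (hσ.eigenvalues_nonneg j) (inv_nonneg.2 (hρ.eigenvalues_nonneg i))

theorem mpow_half_eq_jointCfc (hσ : σ.IsHermitian) (hρ : ρ.PosSemidef) :
    mpow ρ (1 / 2) = jointCfc hσ hρ.1 fun _ y => √y := by
  rw [mpow_eq_cfc_sqrt hρ, cfc_right_eq_jointCfc hσ hρ.1]

theorem modularResolvent_equation (hσ : σ.PosSemidef) (hρ : ρ.PosSemidef) {t : ℝ} (ht : 0 < t) :
    (t : ℂ) • modularResolvent hσ.1 hρ.1 t + σ * modularResolvent hσ.1 hρ.1 t * mpow ρ (-1) =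
      mpow ρ (1 / 2) := by
  have h : σ * modularResolvent hσ.1 hρ.1 t * mpow ρ (-1) =
      cfc (fun x : ℝ => x) σ * modularResolvent hσ.1 hρ.1 t * cfc (fun x : ℝ => x⁻¹) ρ := by
    rw [cfc_id_of_isHermitian hσ.1, mpow_neg_one_eq_cfc_inv hρ]
  rw [h, modularResolvent, smul_jointCfc, cfc_mul_jointCfc_mul_cfc, jointCfc_add,
    mpow_half_eq_jointCfc hσ.1 hρ]
  refine jointCfc_congr _ _ fun j i => ?_
  have h1 := eigenvalues_mul_inv_nonneg hσ hρ j i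
  have h2 : t + hσ.1.eigenvalues j * (hρ.1.eigenvalues i)⁻¹ ≠ 0 := by positivity
  calc _ = √(hρ.1.eigenvalues i) * ((t + hσ.1.eigenvalues j * (hρ.1.eigenvalues i)⁻¹) *
        (t + hσ.1.eigenvalues j * (hρ.1.eigenvalues i)⁻¹)⁻¹) := by ring
    _ = _ := by rw [mul_inv_cancel₀ h2, mul_one]

theorem jointCfc_mul_mpow_zero (hσ : σ.IsHermitian) (hρ : ρ.PosSemidef) {h : ℝ → ℝ → ℝ}
    (h0 : ∀ x, h x 0 = 0) : jointCfc hσ hρ.1 h * mpow ρ 0 = jointCfc hσ hρ.1 h := by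
  have h1 := cfc_mul_jointCfc_mul_cfc hσ hρ.1 (fun _ => 1) (fun x => if x = 0 then 0 else x ^ (0 : ℝ)) h
  rw [cfc_one_of_isHermitian hσ, Matrix.one_mul] at h1
  rw [mpow, h1]
  refine jointCfc_congr _ _ fun j i => ?_
  by_cases h : hρ.1.eigenvalues i = 0 <;> simp [h, h0]

theorem hsNorm_mpow_half (hρ : IsDensity ρ) : hsNorm (mpow ρ (1 / 2)) = 1 := by
  rw [← sq_eq_sq₀ (hsNorm_nonneg _) zero_le_one, hsNorm_sq, conjTranspose_mpow,
    mpow_half_mul_self hρ.1, hρ.2]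
  simp

theorem hsNorm_real_smul_jointCfc_le (hσ : σ.PosSemidef) (hρ : IsDensity ρ) {h : ℝ → ℝ → ℝ} {c : ℝ}
    (hc : 0 ≤ c) (hh : ∀ j i, |h (hσ.1.eigenvalues j) (hρ.1.1.eigenvalues i)| ≤
      c * √(hρ.1.1.eigenvalues i)) : hsNorm (jointCfc hσ.1 hρ.1.1 h) ≤ c := by
  have h1 : hsNorm (jointCfc hσ.1 hρ.1.1 h) ≤ hsNorm (jointCfc hσ.1 hρ.1.1 fun _ y => c * √y) :=
    hsNorm_jointCfc_le _ _ fun j i => (hh j i).trans (le_abs_self _)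
  refine h1.trans_eq ?_
  rw [← smul_jointCfc, ← mpow_half_eq_jointCfc hσ.1 hρ.1, hsNorm, map_smul, norm_smul,
    ← hsNorm, hsNorm_mpow_half hρ, Complex.norm_real, norm_of_nonneg hc, mul_one]

theorem hsNorm_modularResolvent_le (hσ : σ.PosSemidef) (hρ : IsDensity ρ) {t : ℝ} (ht : 0 < t) :
    hsNorm (modularResolvent hσ.1 hρ.1.1 t) ≤ 1 / t := by
  refine hsNorm_real_smul_jointCfc_le hσ hρ (by positivity) fun j i => ?_
  have h1 := eigenvalues_mul_inv_nonneg hσ hρ.1 j i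
  rw [abs_of_nonneg (by positivity), mul_comm, one_div]
  exact mul_le_mul_of_nonneg_right (inv_anti₀ ht (by linarith)) (sqrt_nonneg _)

theorem inv_sub_modularResolvent (hσ : σ.IsHermitian) (hρ : ρ.PosSemidef) (t : ℝ) :
    ((t⁻¹ : ℝ) : ℂ) • mpow ρ (1 / 2) - modularResolvent hσ hρ.1 t =
      jointCfc hσ hρ.1 fun x y => √y * (t⁻¹ - (t + x * y⁻¹)⁻¹) := by
  rw [mpow_half_eq_jointCfc hσ hρ, smul_jointCfc, modularResolvent, jointCfc_sub]
  exact jointCfc_congr _ _ fun j i => by ring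

theorem hsNorm_inv_sub_modularResolvent_le (hσ : σ.PosSemidef) (hρ : IsDensity ρ) {d : ℝ}
    (hd : 0 ≤ d) (h : ∀ j i, hσ.1.eigenvalues j * (hρ.1.1.eigenvalues i)⁻¹ ≤ d) {t : ℝ}
    (ht : 0 < t) :
    hsNorm (((t⁻¹ : ℝ) : ℂ) • mpow ρ (1 / 2) - modularResolvent hσ.1 hρ.1.1 t) ≤ d / t ^ 2 := by
  rw [inv_sub_modularResolvent hσ.1 hρ.1]
  refine hsNorm_real_smul_jointCfc_le hσ hρ (by positivity) fun j i => ?_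
  have h1 := eigenvalues_mul_inv_nonneg hσ hρ.1 j i
  have h2 := h j i
  set z := hσ.1.eigenvalues j * (hρ.1.1.eigenvalues i)⁻¹
  have h3 : t⁻¹ - (t + z)⁻¹ = z / (t * (t + z)) := by
    have : t + z ≠ 0 := by positivity
    field_simp
    ring
  rw [h3, abs_of_nonneg (by positivity), mul_comm]
  refine mul_le_mul_of_nonneg_right ?_ (sqrt_nonneg _)
  exact div_le_div₀ hd h2 (by positivity) (by nlinarith)

/-! ### The isometry from `N` into the algebra -/

/-- The map `X ↦ X ρ_N^(-1/2) ρ^(1/2)`, a partial isometry on `N`. -/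
def transfer (N : StarSubalgebra ℂ (Matrix n n ℂ)) (ρ : Matrix n n ℂ) :
    Matrix n n ℂ →ₗ[ℂ] Matrix n n ℂ :=
  LinearMap.mulRight ℂ (mpow (condExp N ρ) (-(1 / 2)) * mpow ρ (1 / 2))

theorem transfer_apply (X : Matrix n n ℂ) :
    transfer N ρ X = X * mpow (condExp N ρ) (-(1 / 2)) * mpow ρ (1 / 2) := by
  rw [transfer, LinearMap.mulRight_apply, Matrix.mul_assoc]

theorem conjTranspose_transfer (X : Matrix n n ℂ) :
    (transfer N ρ X)ᴴ = mpow ρ (1 / 2) * (mpow (condExp N ρ) (-(1 / 2)) * Xᴴ) := by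
  rw [transfer_apply, Matrix.conjTranspose_mul, Matrix.conjTranspose_mul, conjTranspose_mpow,
    conjTranspose_mpow]

theorem transfer_mpow_half (hρ : ρ.PosSemidef) :
    transfer N ρ (mpow (condExp N ρ) (1 / 2)) = mpow ρ (1 / 2) := by
  rw [transfer_apply, mpow_mul_mpow (posSemidef_condExp hρ), add_neg_cancel,
    mpow_condExp_zero_mul_mpow_half hρ]

theorem mpow_condExp_mem (N : StarSubalgebra ℂ (Matrix n n ℂ)) (ρ : Matrix n n ℂ) (s : ℝ) :
    mpow (condExp N ρ) s ∈ N := cfc_mem_starSubalgebra (condExp_mem N ρ) _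

/-- Cyclicity brings ρ next to an element of N, where it may be replaced by ρ_N; then ρ_N^(-1/2) ρ_N
ρ_N^(-1/2) is the support projection, which X absorbs. -/
theorem trace_transfer_mul_transfer (hρ : ρ.PosSemidef) {X : Matrix n n ℂ} (hX : X ∈ N)
    (hX0 : X * mpow (condExp N ρ) 0 = X) :
    ((transfer N ρ X)ᴴ * transfer N ρ X).trace = (Xᴴ * X).trace := by
  have hE := posSemidef_condExp (N := N) hρ
  rw [conjTranspose_transfer, transfer_apply]
  set a := mpow (condExp N ρ) (-(1 / 2)) with ha
  have haN : a ∈ N := mpow_condExp_mem N ρ _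
  have hm : a * Xᴴ * X * a ∈ N := mul_mem (mul_mem (mul_mem haN (star_mem hX)) hX) haN
  calc _ = (mpow ρ (1 / 2) * (a * Xᴴ * X * a * mpow ρ (1 / 2))).trace := by
        simp only [Matrix.mul_assoc]
    _ = (a * Xᴴ * X * a * ρ).trace := by
        rw [Matrix.trace_mul_comm, Matrix.mul_assoc _ (mpow ρ _), mpow_half_mul_self hρ]
    _ = (a * (Xᴴ * X * (a * condExp N ρ))).trace := by
        rw [← trace_mul_condExp N ρ hm]; simp only [Matrix.mul_assoc]
    _ = (Xᴴ * (X * (a * condExp N ρ * a))).trace := by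
        rw [Matrix.trace_mul_comm]; simp only [Matrix.mul_assoc]
    _ = _ := by
        have h : a * condExp N ρ * a = mpow (condExp N ρ) 0 := by
          rw [ha, ← congrArg (mpow (condExp N ρ) (-(1 / 2)) * ·) (mpow_one hE), mpow_mul_mpow hE,
            mpow_mul_mpow hE]
          norm_num
        rw [h, hX0]

theorem hsNorm_transfer (hρ : ρ.PosSemidef) {X : Matrix n n ℂ} (hX : X ∈ N)
    (hX0 : X * mpow (condExp N ρ) 0 = X) : hsNorm (transfer N ρ X) = hsNorm X := by
  rw [← sq_eq_sq₀ (hsNorm_nonneg _) (hsNorm_nonneg _), hsNorm_sq, hsNorm_sq,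
    trace_transfer_mul_transfer hρ hX hX0]

theorem trace_transfer_mul_mpow_half (hρ : ρ.PosSemidef) {X : Matrix n n ℂ} (hX : X ∈ N) :
    ((transfer N ρ X)ᴴ * mpow ρ (1 / 2)).trace = (Xᴴ * mpow (condExp N ρ) (1 / 2)).trace := by
  have hE := posSemidef_condExp (N := N) hρ
  rw [conjTranspose_transfer]
  set a := mpow (condExp N ρ) (-(1 / 2)) with ha
  have haN : a * Xᴴ ∈ N := mul_mem (mpow_condExp_mem N ρ _) (star_mem hX)
  rw [Matrix.trace_mul_comm, ← Matrix.mul_assoc, mpow_half_mul_self hρ, Matrix.trace_mul_comm,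
    ← trace_mul_condExp N ρ haN, Matrix.mul_assoc, Matrix.trace_mul_comm,
    Matrix.mul_assoc]
  have h : condExp N ρ * a = mpow (condExp N ρ) (1 / 2) := by
    rw [ha, ← congrArg (· * mpow (condExp N ρ) (-(1 / 2))) (mpow_one hE), mpow_mul_mpow hE]
    norm_num
  rw [h]

theorem posSemidef_one_sub_mpow_zero (hρ : ρ.PosSemidef) : (1 - mpow ρ 0).PosSemidef := by
  have := Matrix.posSemidef_conjTranspose_mul_self (1 - mpow ρ 0)
  rwa [conjTranspose_one_sub_mpow_zero, one_sub_mpow_zero_mul_self hρ] at this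

/-- This is U*ΔU ≤ Δ_N. With C = (X a)* σ (X a) the two sides are Tr(C ρ^0) and Tr C, so the loss is
Tr(C (1 - ρ^0)) ≥ 0, and it vanishes for invertible ρ. -/
theorem trace_transfer_modular_le (hσ : σ.PosSemidef) (hρ : ρ.PosSemidef) {X : Matrix n n ℂ}
    (hX : X ∈ N) :
    ((transfer N ρ X)ᴴ * (σ * transfer N ρ X * mpow ρ (-1))).trace.re ≤
      (Xᴴ * (condExp N σ * X * mpow (condExp N ρ) (-1))).trace.re := by
  have hE := posSemidef_condExp (N := N) hρ
  rw [conjTranspose_transfer, transfer_apply]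
  set a := mpow (condExp N ρ) (-(1 / 2)) with ha
  have haN : a ∈ N := mpow_condExp_mem N ρ _
  have haa : a * a = mpow (condExp N ρ) (-1) := by
    rw [ha, mpow_mul_mpow hE]; norm_num
  have has : aᴴ = a := conjTranspose_mpow _ _
  set C := (X * a)ᴴ * σ * (X * a) with hC
  have hCp : C.PosSemidef := hσ.conjTranspose_mul_mul_same _
  have h1 : (mpow ρ (1 / 2) * (a * Xᴴ) * (σ * (X * a * mpow ρ (1 / 2)) * mpow ρ (-1))).trace =
      (C * mpow ρ 0).trace := by
    have e : mpow ρ (1 / 2) * (mpow ρ (-1) * mpow ρ (1 / 2)) = mpow ρ 0 := by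
      rw [mpow_mul_mpow hρ, mpow_mul_mpow hρ]; norm_num
    rw [Matrix.mul_assoc, Matrix.trace_mul_comm, hC, ← e, Matrix.conjTranspose_mul, has]
    simp only [Matrix.mul_assoc]
  have h2 : (Xᴴ * (condExp N σ * X * mpow (condExp N ρ) (-1))).trace = C.trace := by
    have hm : X * mpow (condExp N ρ) (-1) * Xᴴ ∈ N :=
      mul_mem (mul_mem hX (mpow_condExp_mem N ρ _)) (star_mem hX)
    calc _ = (condExp N σ * (X * mpow (condExp N ρ) (-1) * Xᴴ)).trace := by
          rw [Matrix.trace_mul_comm]; simp only [Matrix.mul_assoc]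
      _ = (X * a * (a * Xᴴ * σ)).trace := by
          rw [Matrix.trace_mul_comm, trace_mul_condExp N σ hm, ← haa]
          simp only [Matrix.mul_assoc]
      _ = _ := by
          rw [Matrix.trace_mul_comm, hC, Matrix.conjTranspose_mul, has]
  have h3 := trace_mul_re_nonneg hCp (posSemidef_one_sub_mpow_zero hρ)
  rw [Matrix.mul_sub, Matrix.mul_one, Matrix.trace_sub, Complex.sub_re] at h3
  rw [h1, h2]
  linarith

theorem trace_modular_re_nonneg (hσ : σ.PosSemidef) (hρ : ρ.PosSemidef) (X : Matrix n n ℂ) :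
    0 ≤ (Xᴴ * (σ * X * mpow ρ (-1))).trace.re := by
  rw [← Matrix.mul_assoc, ← Matrix.mul_assoc]
  refine trace_mul_re_nonneg (hσ.conjTranspose_mul_mul_same _) ?_
  rw [mpow_neg_one_eq_cfc_inv hρ]
  exact posSemidef_cfc hρ.1 fun i => inv_nonneg.2 (hρ.eigenvalues_nonneg i)

theorem trace_modular_comm (hσ : σ.IsHermitian) (ρ X Y : Matrix n n ℂ) :
    (Xᴴ * (σ * Y * mpow ρ (-1))).trace.re = (Yᴴ * (σ * X * mpow ρ (-1))).trace.re := by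
  have h : star (Xᴴ * (σ * Y * mpow ρ (-1))).trace = (Yᴴ * (σ * X * mpow ρ (-1))).trace := by
    rw [← Matrix.trace_conjTranspose]
    simp only [Matrix.conjTranspose_mul, Matrix.conjTranspose_conjTranspose, conjTranspose_mpow,
      hσ.eq]
    rw [Matrix.mul_assoc, Matrix.trace_mul_comm]
    simp only [Matrix.mul_assoc]
  rw [← h]
  simp

theorem trace_conjTranspose_mul_comm_re {m : Type*} [Fintype m] (X Y : Matrix m m ℂ) :
    (Xᴴ * Y).trace.re = (Yᴴ * X).trace.re := by
  have h : star (Xᴴ * Y).trace = (Yᴴ * X).trace := by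
    rw [← Matrix.trace_conjTranspose, Matrix.conjTranspose_mul, Matrix.conjTranspose_conjTranspose]
  rw [← h]
  simp

/-- The difference between the transferred resolvent of `N` and the resolvent is controlled by the
difference of the quadratic forms of the resolvents. -/
theorem mul_hsNorm_transfer_sub_sq_le (hσ : σ.PosSemidef) (hρ : ρ.PosSemidef) {t : ℝ}
    {X R : Matrix n n ℂ} (hX : X ∈ N) (hX0 : X * mpow (condExp N ρ) 0 = X)
    (hXt : (t : ℂ) • X + condExp N σ * X * mpow (condExp N ρ) (-1) = mpow (condExp N ρ) (1 / 2))
    (hR : (t : ℂ) • R + σ * R * mpow ρ (-1) = mpow ρ (1 / 2)) :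
    t * hsNorm (transfer N ρ X - R) ^ 2 ≤
      (Rᴴ * mpow ρ (1 / 2)).trace.re - (Xᴴ * mpow (condExp N ρ) (1 / 2)).trace.re := by
  have h1 := congrArg Complex.re (trace_transfer_mul_transfer hρ hX hX0)
  have h2 := congrArg Complex.re (trace_transfer_mul_mpow_half hρ hX)
  have h3 := trace_transfer_modular_le (N := N) hσ hρ hX
  have key : ∀ {C S P η : Matrix n n ℂ} (Z : Matrix n n ℂ), (t : ℂ) • C + S * C * P = η →
      (Zᴴ * η).trace.re = t * (Zᴴ * C).trace.re + (Zᴴ * (S * C * P)).trace.re := by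
    intro C S P η Z h
    rw [← h, Matrix.mul_add, Matrix.mul_smul, Matrix.trace_add, Matrix.trace_smul]
    simp
  have h4 := key X hXt
  have h5 := key R hR
  have h6 := key (transfer N ρ X) hR
  set T := transfer N ρ X
  -- With T = U X, expand ⟨T - R, (t + Δ)(T - R)⟩, which is at least t‖T - R‖². The T-term is at
  -- most ⟨X, (t + Δ_N) X⟩ = ⟨X, ρ_N^(1/2)⟩, each cross term is -⟨T, ρ^(1/2)⟩ = -⟨X, ρ_N^(1/2)⟩, and
  -- the R-term is ⟨R, ρ^(1/2)⟩.
  have h7 := trace_modular_re_nonneg hσ hρ (T - R)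
  have h8 := trace_modular_comm hσ.1 ρ R T
  have h9 := trace_conjTranspose_mul_comm_re R T
  rw [hsNorm_sq]
  simp only [Matrix.conjTranspose_sub, Matrix.mul_sub, Matrix.sub_mul, Matrix.trace_sub,
    Complex.sub_re] at h7 ⊢
  rw [h9, h1]
  nlinarith

end QRE
end

noncomputable section

namespace QRE

open Set MeasureTheory Filter Real

variable {n : Type*} [Fintype n] [DecidableEq n] {N : StarSubalgebra ℂ (Matrix n n ℂ)}
  {A σ ρ : Matrix n n ℂ}

/-! ### Integral representations -/

/-! ### Integral representations and bounds on the resolvent gap. -/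

theorem jointCfc_eq_sum_single (hσ : σ.IsHermitian) (hρ : ρ.IsHermitian) (h : ℝ → ℝ → ℝ) :
    jointCfc hσ hρ h = ∑ j, ∑ i, (h (hσ.eigenvalues j) (hρ.eigenvalues i) : ℂ) •
      ((hσ.eigenvectorUnitary : Matrix n n ℂ) *
        Matrix.single j i ((star (hσ.eigenvectorUnitary : Matrix n n ℂ) *
          (hρ.eigenvectorUnitary : Matrix n n ℂ)) j i) *
        star (hρ.eigenvectorUnitary : Matrix n n ℂ)) := by
  rw [jointCfc]
  conv_lhs => rw [Matrix.matrix_eq_sum_single (Matrix.of _)]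
  simp only [Matrix.mul_sum, Matrix.sum_mul]
  refine Finset.sum_congr rfl fun j _ => Finset.sum_congr rfl fun i _ => ?_
  rw [← Matrix.smul_mul, ← Matrix.mul_smul, Matrix.smul_single, Matrix.of_apply, smul_eq_mul]

/-- A `jointCfc` is a finite combination of fixed matrices with scalar coefficients, so the scalar
formula for x^β integrates term by term. The linear map L carries it to a normed space, where the
integral is taken. -/
theorem integral_map_jointCfc {E : Type*} [NormedAddCommGroup E] [NormedSpace ℂ E] [CompleteSpace E]
    (hσ : σ.PosSemidef) (hρ : ρ.PosSemidef) {β : ℝ} (hβ : β ∈ Ioo (0 : ℝ) 1)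
    (L : Matrix n n ℂ →ₗ[ℂ] E) :
    IntegrableOn (fun t => L (jointCfc hσ.1 hρ.1
        fun x y => √y * rpowIntegrand₀₁ β t (x * y⁻¹))) (Ioi 0) ∧
      ∫ t in Ioi 0, L (jointCfc hσ.1 hρ.1 fun x y => √y * rpowIntegrand₀₁ β t (x * y⁻¹)) =
        L (jointCfc hσ.1 hρ.1 fun x y => √y * (π / sin (β * π) * (x * y⁻¹) ^ β)) := by
  obtain ⟨v, hv⟩ : ∃ v : n → n → E, ∀ h : ℝ → ℝ → ℝ, L (jointCfc hσ.1 hρ.1 h) =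
      ∑ j, ∑ i, (h (hσ.1.eigenvalues j) (hρ.1.eigenvalues i) : ℂ) • v j i :=
    ⟨fun j i => L ((hσ.1.eigenvectorUnitary : Matrix n n ℂ) *
        Matrix.single j i ((star (hσ.1.eigenvectorUnitary : Matrix n n ℂ) *
          (hρ.1.eigenvectorUnitary : Matrix n n ℂ)) j i) *
        star (hρ.1.eigenvectorUnitary : Matrix n n ℂ)), fun h => by
      rw [jointCfc_eq_sum_single]; simp only [map_sum, map_smul]⟩
  simp only [hv]
  have hi : ∀ j i, IntegrableOn (fun t => (√(hρ.1.eigenvalues i) *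
      rpowIntegrand₀₁ β t (hσ.1.eigenvalues j * (hρ.1.eigenvalues i)⁻¹) : ℝ)) (Ioi 0) :=
    fun j i => (integrableOn_rpowIntegrand₀₁_Ioi hβ (eigenvalues_mul_inv_nonneg hσ hρ j i)).const_mul _
  have hi' : ∀ j i, IntegrableOn (fun t => ((√(hρ.1.eigenvalues i) *
      rpowIntegrand₀₁ β t (hσ.1.eigenvalues j * (hρ.1.eigenvalues i)⁻¹) : ℝ) : ℂ) • v j i) (Ioi 0) :=
    fun j i => ((hi j i).ofReal (𝕜 := ℂ)).smul_const (v j i)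
  refine ⟨integrable_finsetSum _ fun j _ => integrable_finsetSum _ fun i _ => hi' j i, ?_⟩
  rw [integral_finsetSum _ fun j _ => integrable_finsetSum _ fun i _ => hi' j i]
  refine Finset.sum_congr rfl fun j _ => ?_
  rw [integral_finsetSum _ fun i _ => hi' j i]
  refine Finset.sum_congr rfl fun i _ => ?_
  rw [integral_smul_const, integral_complex_ofReal, integral_const_mul,
    integral_rpowIntegrand₀₁ hβ (eigenvalues_mul_inv_nonneg hσ hρ j i)]

theorem jointCfc_sqrt_mul_rpow (hσ : σ.PosSemidef) (hρ : ρ.PosSemidef) {β : ℝ} (hβ : 0 < β) (c : ℝ) :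
    jointCfc hσ.1 hρ.1 (fun x y => √y * (c * (x * y⁻¹) ^ β)) =
      (c : ℂ) • (mpow σ β * mpow ρ (1 / 2 - β)) := by
  rw [mpow, mpow, cfc_mul_cfc_eq_jointCfc hσ.1 hρ.1, smul_jointCfc]
  refine jointCfc_congr _ _ fun j i => ?_
  by_cases hs : hσ.1.eigenvalues j = 0
  · simp [hs, zero_rpow hβ.ne']
  by_cases hp : hρ.1.eigenvalues i = 0
  · simp [hp]
  have hp0 := (hρ.eigenvalues_nonneg i).lt_of_ne' hp
  simp only [hs, hp, if_false]
  rw [mul_rpow (hσ.eigenvalues_nonneg j) (inv_nonneg.2 hp0.le), sqrt_eq_rpow, inv_rpow hp0.le,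
    rpow_sub hp0]
  ring

theorem sum_overlap_mul (hσ : σ.IsHermitian) (hρ : IsDensity ρ) :
    ∑ i, ∑ j, hρ.1.1.eigenvalues i * overlap hσ hρ.1.1 j i = 1 := by
  have h := trace_conjTranspose_jointCfc_mul_jointCfc hσ hρ.1.1 (fun _ _ => 1) fun _ y => y
  rw [jointCfc_one, ← cfc_right_eq_jointCfc hσ hρ.1.1 fun y => y, cfc_id_of_isHermitian hρ.1.1,
    Matrix.conjTranspose_one, Matrix.one_mul] at h
  have h2 := hρ.2.symm.trans h
  simp only [one_mul] at h2
  exact_mod_cast h2.symm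

theorem trace_relEntropy_eq (hσ : σ.IsHermitian) (hρ : ρ.IsHermitian) :
    (ρ * mlog ρ - ρ * mlog σ).trace.re = ∑ i, ∑ j, hρ.eigenvalues i *
      (log (hρ.eigenvalues i) - log (hσ.eigenvalues j)) * overlap hσ hρ j i := by
  have h1 := trace_conjTranspose_jointCfc_mul_jointCfc hσ hρ (fun _ y => y) fun _ y => log y
  have h2 := trace_conjTranspose_jointCfc_mul_jointCfc hσ hρ (fun _ y => y) fun x _ => log x
  rw [← cfc_right_eq_jointCfc hσ hρ fun y => y, ← cfc_right_eq_jointCfc hσ hρ log,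
    cfc_id_of_isHermitian hρ, hρ.eq] at h1
  rw [← cfc_right_eq_jointCfc hσ hρ fun y => y, ← cfc_left_eq_jointCfc hσ hρ log,
    cfc_id_of_isHermitian hρ, hρ.eq] at h2
  rw [mlog, mlog, Matrix.trace_sub, h1, h2, ← Complex.ofReal_sub, Complex.ofReal_re]
  simp only [← Finset.sum_sub_distrib]
  refine Finset.sum_congr rfl fun i _ => Finset.sum_congr rfl fun j _ => ?_
  ring

/-- If Q is the kernel projection of σ then ρ Q = 0, and the squared norm of Q ρ is a sum of
nonnegative terms that must all vanish. This removes the terms with log 0 from the entropy. -/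
theorem eigenvalues_mul_overlap_eq_zero (hσ : σ.IsHermitian) (hρ : ρ.IsHermitian)
    (h : LinearMap.ker σ.mulVecLin ≤ LinearMap.ker ρ.mulVecLin) {j : n}
    (hj : hσ.eigenvalues j = 0) (i : n) : hρ.eigenvalues i * overlap hσ hρ j i = 0 := by
  classical
  have h1 : σ * cfc (fun x : ℝ => if x = 0 then 1 else 0) σ = 0 := by
    nth_rewrite 1 [← cfc_id_of_isHermitian hσ]
    rw [cfc_mul_cfc hσ, ← cfc_const_zero ℝ σ]
    exact cfc_congr_eigenvalues hσ fun i => by simp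
  have h2 := mul_eq_zero_of_ker_le h h1
  have h3 : cfc (fun x : ℝ => if x = 0 then 1 else 0) σ * cfc (fun y : ℝ => y) ρ = 0 := by
    rw [cfc_id_of_isHermitian hρ, ← Matrix.conjTranspose_eq_zero, Matrix.conjTranspose_mul,
      conjTranspose_cfc, hρ.eq, h2]
  rw [cfc_mul_cfc_eq_jointCfc hσ hρ] at h3
  have h4 := hsNorm_jointCfc_sq hσ hρ fun x y => (if x = 0 then 1 else 0) * y
  rw [h3, hsNorm, map_zero, norm_zero, zero_pow two_ne_zero, eq_comm,
    Finset.sum_eq_zero_iff_of_nonneg fun i _ => Finset.sum_nonneg fun j _ =>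
      mul_nonneg (sq_nonneg _) (overlap_nonneg ..)] at h4
  have h5 := (Finset.sum_eq_zero_iff_of_nonneg fun j _ =>
      mul_nonneg (sq_nonneg _) (overlap_nonneg ..)).1 (h4 i (Finset.mem_univ _)) j
      (Finset.mem_univ _)
  simp only [hj, if_true, one_mul, mul_eq_zero, pow_eq_zero_iff two_ne_zero] at h5
  exact mul_eq_zero.2 h5

theorem integral_trace_modularResolvent (hσ : σ.PosSemidef) (hρ : IsDensity ρ)
    (h : LinearMap.ker σ.mulVecLin ≤ LinearMap.ker ρ.mulVecLin) :
    IntegrableOn (fun t : ℝ => ((modularResolvent hσ.1 hρ.1.1 t)ᴴ * mpow ρ (1 / 2)).trace.re -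
        (1 + t)⁻¹) (Ioi 0) ∧
      ∫ t in Ioi 0, (((modularResolvent hσ.1 hρ.1.1 t)ᴴ * mpow ρ (1 / 2)).trace.re - (1 + t)⁻¹) =
        (ρ * mlog ρ - ρ * mlog σ).trace.re := by
  have hG : ∀ t : ℝ, ((modularResolvent hσ.1 hρ.1.1 t)ᴴ * mpow ρ (1 / 2)).trace.re - (1 + t)⁻¹ =
      ∑ i, ∑ j, hρ.1.1.eigenvalues i * overlap hσ.1 hρ.1.1 j i *
        ((t + hσ.1.eigenvalues j * (hρ.1.1.eigenvalues i)⁻¹)⁻¹ - (1 + t)⁻¹) := by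
    intro t
    rw [mpow_half_eq_jointCfc hσ.1 hρ.1, modularResolvent,
      trace_conjTranspose_jointCfc_mul_jointCfc, Complex.ofReal_re]
    -- The weights sum to Tr ρ = 1, so the subtracted 1 / (1 + t) can be distributed over the terms.
    have e : (1 + t)⁻¹ = (∑ i, ∑ j, hρ.1.1.eigenvalues i * overlap hσ.1 hρ.1.1 j i) * (1 + t)⁻¹ := by
      rw [sum_overlap_mul hσ.1 hρ, one_mul]
    conv_lhs => rw [e]
    simp only [Finset.sum_mul, ← Finset.sum_sub_distrib]
    refine Finset.sum_congr rfl fun i _ => Finset.sum_congr rfl fun j _ => ?_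
    have := mul_self_sqrt (hρ.1.eigenvalues_nonneg i)
    linear_combination (t + hσ.1.eigenvalues j * (hρ.1.1.eigenvalues i)⁻¹)⁻¹ *
      overlap hσ.1 hρ.1.1 j i * this
  have hterm : ∀ i j,
      IntegrableOn (fun t : ℝ => hρ.1.1.eigenvalues i * overlap hσ.1 hρ.1.1 j i *
        ((t + hσ.1.eigenvalues j * (hρ.1.1.eigenvalues i)⁻¹)⁻¹ - (1 + t)⁻¹)) (Ioi 0) ∧
      ∫ t in Ioi 0, hρ.1.1.eigenvalues i * overlap hσ.1 hρ.1.1 j i *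
        ((t + hσ.1.eigenvalues j * (hρ.1.1.eigenvalues i)⁻¹)⁻¹ - (1 + t)⁻¹) =
        hρ.1.1.eigenvalues i * (log (hρ.1.1.eigenvalues i) - log (hσ.1.eigenvalues j)) *
          overlap hσ.1 hρ.1.1 j i := by
    intro i j
    by_cases h0 : hρ.1.1.eigenvalues i * overlap hσ.1 hρ.1.1 j i = 0
    · rw [mul_right_comm, h0]
      simp
    have hp : 0 < hρ.1.1.eigenvalues i :=
      (hρ.1.eigenvalues_nonneg i).lt_of_ne' (left_ne_zero_of_mul h0)
    have hs : 0 < hσ.1.eigenvalues j := (hσ.eigenvalues_nonneg j).lt_of_ne' fun hj =>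
      h0 (eigenvalues_mul_overlap_eq_zero hσ.1 hρ.1.1 h hj i)
    obtain ⟨hi, hv⟩ := integrableOn_and_integral_inv_add_sub (mul_pos hs (inv_pos.2 hp))
    refine ⟨hi.const_mul _, ?_⟩
    rw [integral_const_mul, hv, log_mul hs.ne' (inv_pos.2 hp).ne', log_inv]
    ring
  simp only [hG, trace_relEntropy_eq hσ.1 hρ.1.1]
  refine ⟨integrable_finsetSum _ fun i _ => integrable_finsetSum _ fun j _ => (hterm i j).1, ?_⟩
  rw [integral_finsetSum _ fun i _ => integrable_finsetSum _ fun j _ => (hterm i j).1]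
  refine Finset.sum_congr rfl fun i _ => ?_
  rw [integral_finsetSum _ fun j _ => (hterm i j).1]
  exact Finset.sum_congr rfl fun j _ => (hterm i j).2

/-! ### The stability estimate -/

theorem hsNorm_sub_le {m : Type*} [Fintype m] (X Y : Matrix m m ℂ) :
    hsNorm (X - Y) ≤ hsNorm X + hsNorm Y := by
  rw [hsNorm, map_sub]
  exact norm_sub_le _ _

theorem transfer_jointCfc_sqrt_mul_rpow (hσ : σ.PosSemidef) (hρ : ρ.PosSemidef)
    (hσE : (condExp N σ).PosSemidef) (hρE : (condExp N ρ).PosSemidef) {β : ℝ} (hβ : 0 < β) (c : ℝ) :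
    jointCfc hσ.1 hρ.1 (fun x y => √y * (c * (x * y⁻¹) ^ β)) -
      transfer N ρ (jointCfc hσE.1 hρE.1 (fun x y => √y * (c * (x * y⁻¹) ^ β))) =
      (-c : ℂ) • (mpow (condExp N σ) β * mpow (condExp N ρ) (-β) * mpow ρ (1 / 2)
        - mpow σ β * mpow ρ (1 / 2 - β)) := by
  rw [jointCfc_sqrt_mul_rpow hσ hρ hβ, jointCfc_sqrt_mul_rpow hσE hρE hβ, map_smul, transfer_apply,
    Matrix.mul_assoc (mpow (condExp N σ) β), mpow_mul_mpow hρE,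
    show 1 / 2 - β + -(1 / 2) = -β by ring, smul_sub, neg_smul, neg_smul]
  abel

/-- The Hilbert-Schmidt distance between the transferred resolvent of `N` and the resolvent. -/
def resolventGap (N : StarSubalgebra ℂ (Matrix n n ℂ)) (hσ : σ.PosSemidef) (hρ : ρ.PosSemidef)
    (t : ℝ) : ℝ :=
  hsNorm (transfer N ρ (modularResolvent (isHermitian_condExp (N := N) hσ.1)
    (isHermitian_condExp (N := N) hρ.1) t) - modularResolvent hσ.1 hρ.1 t)

theorem modularResolvent_condExp_mul_mpow_zero (hσ : σ.PosSemidef) (hρ : ρ.PosSemidef) (t : ℝ) :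
    modularResolvent (isHermitian_condExp (N := N) hσ.1) (isHermitian_condExp (N := N) hρ.1) t *
      mpow (condExp N ρ) 0 =
    modularResolvent (isHermitian_condExp (N := N) hσ.1) (isHermitian_condExp (N := N) hρ.1) t :=
  jointCfc_mul_mpow_zero _ (posSemidef_condExp hρ) fun x => by simp

theorem modularResolvent_condExp_mem (hσ : σ.PosSemidef) (hρ : ρ.PosSemidef) (t : ℝ) :
    modularResolvent (isHermitian_condExp (N := N) hσ.1) (isHermitian_condExp (N := N) hρ.1) t ∈ N :=
  jointCfc_mem _ _ (condExp_mem N σ) (condExp_mem N ρ) _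

theorem resolventGap_le (hσ : σ.PosSemidef) (hρ : IsDensity ρ) {t : ℝ} (ht : 0 < t) :
    resolventGap N hσ hρ.1 t ≤ 2 / t := by
  have h1 := hsNorm_modularResolvent_le hσ hρ ht
  have h2 := hsNorm_modularResolvent_le (posSemidef_condExp (N := N) hσ) (hρ.condExp (N := N)) ht
  rw [← hsNorm_transfer hρ.1 (modularResolvent_condExp_mem hσ hρ.1 t)
    (modularResolvent_condExp_mul_mpow_zero hσ hρ.1 t)] at h2
  have h4 : 2 / t = 1 / t + 1 / t := by ring
  rw [h4]
  exact (hsNorm_sub_le _ _).trans (add_le_add h2 h1)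

/-- Since U maps t⁻¹ ρ_N^(1/2) to t⁻¹ ρ^(1/2), this leading part cancels in the gap. Each remainder
t⁻¹ - (t + z)⁻¹ = z / (t (t + z)) is at most d / t². -/
theorem resolventGap_le_of_eigenvalues_le (hσ : σ.PosSemidef) (hρ : IsDensity ρ) {d : ℝ} (hd : 0 ≤ d)
    (h : ∀ j i, hσ.1.eigenvalues j * (hρ.1.1.eigenvalues i)⁻¹ ≤ d)
    (hE : ∀ j i, (isHermitian_condExp (N := N) hσ.1).eigenvalues j *
      ((isHermitian_condExp (N := N) hρ.1.1).eigenvalues i)⁻¹ ≤ d) {t : ℝ} (ht : 0 < t) :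
    resolventGap N hσ hρ.1 t ≤ 2 * d / t ^ 2 := by
  have h1 := hsNorm_inv_sub_modularResolvent_le hσ hρ hd h ht
  have h2 := hsNorm_inv_sub_modularResolvent_le (posSemidef_condExp (N := N) hσ)
    (hρ.condExp (N := N)) hd hE ht
  set Y := modularResolvent (isHermitian_condExp (N := N) hσ.1)
    (isHermitian_condExp (N := N) hρ.1.1) t with hY
  set Z := ((t⁻¹ : ℝ) : ℂ) • mpow (condExp N ρ) (1 / 2) - Y with hZ
  have hZN : Z ∈ N := sub_mem (N.smul_mem (mpow_condExp_mem N ρ _) _)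
    (modularResolvent_condExp_mem hσ hρ.1 t)
  have hZ0 : Z * mpow (condExp N ρ) 0 = Z := by
    rw [hZ, Matrix.sub_mul, Matrix.smul_mul, mpow_mul_mpow (posSemidef_condExp hρ.1), add_zero,
      modularResolvent_condExp_mul_mpow_zero hσ hρ.1]
  have hsub : transfer N ρ Y - modularResolvent hσ.1 hρ.1.1 t =
      (((t⁻¹ : ℝ) : ℂ) • mpow ρ (1 / 2) - modularResolvent hσ.1 hρ.1.1 t) - transfer N ρ Z := by
    rw [hZ, map_sub, map_smul, transfer_mpow_half hρ.1]
    abel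
  have h2' : hsNorm (transfer N ρ Z) ≤ d / t ^ 2 := by
    rw [hsNorm_transfer hρ.1 hZN hZ0]
    exact h2
  have h4 : 2 * d / t ^ 2 = d / t ^ 2 + d / t ^ 2 := by ring
  rw [resolventGap, ← hY, hsub, h4]
  exact (hsNorm_sub_le _ _).trans (add_le_add h1 h2')

/-- The same cancellation identifies the gap, up to t^β, with the difference of the integrands that
represent Δ^β and Δ_N^β. -/
theorem rpow_mul_resolventGap (hσ : σ.PosSemidef) (hρ : ρ.PosSemidef) {β t : ℝ} (ht : 0 < t) :
    t ^ β * resolventGap N hσ hρ t =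
      ‖toHS (jointCfc hσ.1 hρ.1 fun x y => √y * rpowIntegrand₀₁ β t (x * y⁻¹)) -
        (toHS.toLinearMap ∘ₗ transfer N ρ) (jointCfc (isHermitian_condExp (N := N) hσ.1)
          (isHermitian_condExp (N := N) hρ.1) fun x y => √y * rpowIntegrand₀₁ β t (x * y⁻¹))‖ := by
  have hJ : ∀ {σ' ρ' : Matrix n n ℂ} (hσ' : σ'.IsHermitian) (hρ' : ρ'.PosSemidef),
      jointCfc hσ' hρ'.1 (fun x y => √y * rpowIntegrand₀₁ β t (x * y⁻¹)) =
        ((t ^ β : ℝ) : ℂ) • (((t⁻¹ : ℝ) : ℂ) • mpow ρ' (1 / 2) - modularResolvent hσ' hρ'.1 t) := by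
    intro σ' ρ' hσ' hρ'
    rw [inv_sub_modularResolvent hσ' hρ', smul_jointCfc]
    refine jointCfc_congr _ _ fun j i => ?_
    rw [rpowIntegrand₀₁]
    ring
  have hT : ∀ Y, transfer N ρ (((t⁻¹ : ℝ) : ℂ) • mpow (condExp N ρ) (1 / 2) - Y) =
      ((t⁻¹ : ℝ) : ℂ) • mpow ρ (1 / 2) - transfer N ρ Y := fun Y => by
    rw [map_sub, map_smul, transfer_mpow_half hρ]
  rw [hJ hσ.1 hρ, hJ (isHermitian_condExp (N := N) hσ.1) (posSemidef_condExp hρ),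
    LinearMap.comp_apply, LinearEquiv.coe_coe, ← map_sub, map_smul (transfer N ρ), hT, ← smul_sub,
    sub_sub_sub_cancel_left, map_smul, norm_smul, Complex.norm_real,
    norm_of_nonneg (rpow_nonneg ht.le β), resolventGap, hsNorm]

theorem integrableOn_rpow_mul_resolventGap (hσ : σ.PosSemidef) (hρ : ρ.PosSemidef) {β : ℝ}
    (hβ : β ∈ Ioo (0 : ℝ) 1) :
    IntegrableOn (fun t => t ^ β * resolventGap N hσ hρ t) (Ioi 0) ∧
      π / sin (β * π) * defect N ρ σ β ≤ ∫ t in Ioi 0, t ^ β * resolventGap N hσ hρ t := by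
  have hs : 0 < sin (β * π) :=
    sin_pos_of_pos_of_lt_pi (mul_pos hβ.1 pi_pos) (by nlinarith [pi_pos, hβ.2])
  obtain ⟨i1, e1⟩ := integral_map_jointCfc hσ hρ hβ (toHS (n := n)).toLinearMap
  obtain ⟨i2, e2⟩ := integral_map_jointCfc (posSemidef_condExp (N := N) hσ)
    (posSemidef_condExp (N := N) hρ) hβ (toHS.toLinearMap ∘ₗ transfer N ρ)
  have hcongr := setIntegral_congr_fun (μ := volume) measurableSet_Ioi
    fun t (ht : t ∈ Ioi (0 : ℝ)) => rpow_mul_resolventGap (N := N) hσ hρ (β := β) ht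
  refine ⟨(integrableOn_congr_fun (fun t ht => rpow_mul_resolventGap hσ hρ ht)
    measurableSet_Ioi).2 (i1.sub i2).norm, ?_⟩
  rw [hcongr]
  refine le_trans (le_of_eq ?_) (norm_integral_le_integral_norm _)
  have h := integral_sub i1 i2
  rw [e1, e2, LinearMap.comp_apply, ← map_sub,
    transfer_jointCfc_sqrt_mul_rpow hσ hρ (posSemidef_condExp hσ) (posSemidef_condExp hρ) hβ.1, map_smul] at h
  refine Eq.trans ?_ (congrArg norm h).symm
  rw [norm_smul, norm_neg, Complex.norm_real, norm_of_nonneg (by positivity)]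
  rfl

end QRE
end

noncomputable section

namespace QRE

open Set MeasureTheory Filter Real

variable {n : Type*} [Fintype n] [DecidableEq n] {σ ρ : Matrix n n ℂ}

/-! ### Assembly of the estimates. -/

/-- Both stability estimates, for any upper bound `d` of the eigenvalues of the relative modular
operators of `(σ, ρ)` and `(σ_N, ρ_N)`. -/
theorem relEntropy_condExp_add_le (N : StarSubalgebra ℂ (Matrix n n ℂ)) (hρ : IsDensity ρ)
    (hσ : IsDensity σ) {d : ℝ} (hd : 0 ≤ d)
    (h : ∀ j i, hσ.1.1.eigenvalues j * (hρ.1.1.eigenvalues i)⁻¹ ≤ d)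
    (hE : ∀ j i, (isHermitian_condExp (N := N) hσ.1.1).eigenvalues j *
      ((isHermitian_condExp (N := N) hρ.1.1).eigenvalues i)⁻¹ ≤ d) :
    (∀ β : ℝ, 0 < β → β < 1 / 2 →
      relEntropy (condExp N ρ) (condExp N σ)
        + ((constL β d * defect N ρ σ β ^ (1 / (β * (1 - β))) : ℝ) : EReal) ≤ relEntropy ρ σ) ∧
    (∀ β : ℝ, 1 / 2 ≤ β → β < 1 →
      relEntropy (condExp N ρ) (condExp N σ)
        + ((constU β d * defect N ρ σ β ^ (2 / (1 - β)) : ℝ) : EReal) ≤ relEntropy ρ σ) := by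
  by_cases hker : LinearMap.ker σ.mulVecLin ≤ LinearMap.ker ρ.mulVecLin
  swap
  · have : relEntropy ρ σ = ⊤ := if_neg hker
    simp [this]
  have hkerE := ker_condExp_le (N := N) hρ.1 hσ.1 hker
  have hσE := posSemidef_condExp (N := N) hσ.1
  have hρE : IsDensity (condExp N ρ) := hρ.condExp
  obtain ⟨i1, e1⟩ := integral_trace_modularResolvent hσ.1 hρ hker
  obtain ⟨i2, e2⟩ := integral_trace_modularResolvent hσE hρE hkerE
  have hS : relEntropy ρ σ = (((ρ * mlog ρ - ρ * mlog σ).trace.re : ℝ) : EReal) := if_pos hker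
  have hSE : relEntropy (condExp N ρ) (condExp N σ) = (((condExp N ρ * mlog (condExp N ρ) -
      condExp N ρ * mlog (condExp N σ)).trace.re : ℝ) : EReal) := if_pos hkerE
  have hF := i1.sub i2
  have hFD := integral_sub i1 i2
  rw [e1, e2] at hFD
  rw [hS, hSE]
  simp only [← EReal.coe_add, EReal.coe_le_coe_iff]
  set D := (ρ * mlog ρ - ρ * mlog σ).trace.re - (condExp N ρ * mlog (condExp N ρ) -
      condExp N ρ * mlog (condExp N σ)).trace.re with hDdef
  have hv0 : ∀ t, 0 < t → 0 ≤ resolventGap N hσ.1 hρ.1 t := fun t _ => hsNorm_nonneg _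
  have hv1 : ∀ t, 0 < t → resolventGap N hσ.1 hρ.1 t ≤ 2 / t := fun t ht =>
    resolventGap_le hσ.1 hρ ht
  have hv2 : ∀ t, 0 < t → resolventGap N hσ.1 hρ.1 t ≤ 2 * d / t ^ 2 := fun t ht =>
    resolventGap_le_of_eigenvalues_le hσ.1 hρ hd h hE ht
  have hv3 : ∀ t, 0 < t → t * resolventGap N hσ.1 hρ.1 t ^ 2 ≤
      (((modularResolvent hσ.1.1 hρ.1.1 t)ᴴ * mpow ρ (1 / 2)).trace.re - (1 + t)⁻¹) -
      (((modularResolvent hσE.1 hρE.1.1 t)ᴴ * mpow (condExp N ρ) (1 / 2)).trace.re -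
        (1 + t)⁻¹) := fun t ht => by
    -- The regularising terms 1 / (1 + t) cancel, leaving the difference of the resolvent forms.
    rw [sub_sub_sub_cancel_right]
    exact mul_hsNorm_transfer_sub_sq_le hσ.1 hρ.1 (modularResolvent_condExp_mem hσ.1 hρ.1 t)
      (modularResolvent_condExp_mul_mpow_zero hσ.1 hρ.1 t)
      (modularResolvent_equation hσE hρE.1 ht) (modularResolvent_equation hσ.1 hρ.1 ht)
  have hD0 : 0 ≤ D := hFD ▸ setIntegral_nonneg measurableSet_Ioi fun t (ht : 0 < t) =>
    (mul_nonneg ht.le (sq_nonneg _)).trans (hv3 t ht)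
  have hδ : ∀ β, 0 ≤ defect N ρ σ β := fun β => hsNorm_nonneg _
  refine ⟨fun β h0 h1 => ?_, fun β h0 h1 => ?_⟩
  · obtain ⟨hv, hX⟩ := integrableOn_rpow_mul_resolventGap (N := N) hσ.1 hρ.1
      (⟨h0, by linarith⟩ : β ∈ Ioo (0 : ℝ) 1)
    have := constL_mul_rpow_le h0 (by linarith) hd hD0 (hδ β) rfl
      (le_of_integral_of_lt_half h0 h1 hd hF hFD hv0 hv1 hv2 hv3 hv hX rfl)
    linarith
  · obtain ⟨hv, hX⟩ := integrableOn_rpow_mul_resolventGap (N := N) hσ.1 hρ.1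
      (⟨by linarith, h1⟩ : β ∈ Ioo (0 : ℝ) 1)
    have := constU_mul_rpow_le (by linarith) h1 hd hD0 (hδ β)
      (le_of_integral_of_half_le h0 h1 hd hF hFD hv0 hv1 hv2 hv3 hv hX)
    linarith

theorem constU_half (d : ℝ) : constU (1 / 2) d = (π / 4) ^ 4 * (1 + d) ^ (-2 : ℝ) := by
  have h1 : π * (1 / 2) * (1 - 1 / 2) / sin (1 / 2 * π) = π / 4 := by
    rw [show (1 / 2 : ℝ) * π = π / 2 by ring, sin_pi_div_two]
    ring
  have h2 : (2 : ℝ) / (1 - 1 / 2) = (4 : ℕ) := by norm_num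
  have h3 : -(2 * (1 / 2) / (1 - 1 / 2) : ℝ) = -2 := by norm_num
  have h4 : (1 - 1 / 2 : ℝ) / (1 / 2) = 1 := by norm_num
  have h5 : (2 : ℝ) ^ (-2 : ℝ) * (1 / 2 : ℝ) ^ (-2 : ℝ) = 1 := by
    rw [← mul_rpow zero_le_two (by norm_num)]
    norm_num
  rw [constU, h1, h2, h3, h4, rpow_natCast, mul_assoc, h5, mul_one]

theorem defect_half (N : StarSubalgebra ℂ (Matrix n n ℂ)) (ρ σ : Matrix n n ℂ) :
    defect N ρ σ (1 / 2) = hsNorm (mpow (condExp N σ) (1 / 2) * mpow (condExp N ρ) (-(1 / 2)) *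
      mpow ρ (1 / 2) - mpow σ (1 / 2) * mpow ρ 0) := by
  rw [defect, sub_self]

theorem hsOpNorm_nonneg {m : Type*} [Fintype m] (L : Matrix m m ℂ →ₗ[ℂ] Matrix m m ℂ) :
    0 ≤ hsOpNorm L := norm_nonneg _

end QRE
end

/-- Stability of the data processing inequality for the Umegaki relative entropy. The inequalities
`S(ρ‖σ) - S(ρ_N‖σ_N) ≥ c` are written `S(ρ_N‖σ_N) + c ≤ S(ρ‖σ)` in the extended reals, so that
they are meaningful when the entropies are `+∞`. First part: `ρ` invertible. Second part: arbitrary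
`ρ`, where `‖Δ_{σ,ρ}‖` is replaced by `max ‖Δ_{σ,ρ}‖ ‖Δ_{σ_N,ρ_N}‖`. -/
theorem corollary5p1 {n : Type*} [Fintype n] [DecidableEq n]
    (M N : StarSubalgebra ℂ (Matrix n n ℂ)) (hNM : N ≤ M)
    (ρ σ : Matrix n n ℂ) (hρM : ρ ∈ M) (hσM : σ ∈ M)
    (hρ : QRE.IsDensity ρ) (hσ : QRE.IsDensity σ) :
    (ρ.PosDef →
      (∀ β : ℝ, 0 < β → β < 1 / 2 →
        QRE.relEntropy (QRE.condExp N ρ) (QRE.condExp N σ)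
          + ((QRE.constL β (QRE.hsOpNorm (QRE.relModular σ ρ))
              * QRE.defect N ρ σ β ^ (1 / (β * (1 - β))) : ℝ) : EReal)
          ≤ QRE.relEntropy ρ σ) ∧
      (∀ β : ℝ, 1 / 2 ≤ β → β < 1 →
        QRE.relEntropy (QRE.condExp N ρ) (QRE.condExp N σ)
          + ((QRE.constU β (QRE.hsOpNorm (QRE.relModular σ ρ))
              * QRE.defect N ρ σ β ^ (2 / (1 - β)) : ℝ) : EReal)
          ≤ QRE.relEntropy ρ σ) ∧
      (QRE.relEntropy (QRE.condExp N ρ) (QRE.condExp N σ)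
          + (((Real.pi / 4) ^ 4 * (1 + QRE.hsOpNorm (QRE.relModular σ ρ)) ^ (-2 : ℝ)
              * QRE.hsNorm (QRE.mpow (QRE.condExp N σ) (1 / 2)
                  * QRE.mpow (QRE.condExp N ρ) (-(1 / 2)) * QRE.mpow ρ (1 / 2)
                  - QRE.mpow σ (1 / 2)) ^ 4 : ℝ) : EReal)
          ≤ QRE.relEntropy ρ σ)) ∧
    (∀ d : ℝ, d = max (QRE.hsOpNorm (QRE.relModular σ ρ))
        (QRE.hsOpNorm (QRE.relModular (QRE.condExp N σ) (QRE.condExp N ρ))) →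
      (∀ β : ℝ, 0 < β → β < 1 / 2 →
        QRE.relEntropy (QRE.condExp N ρ) (QRE.condExp N σ)
          + ((QRE.constL β d * QRE.defect N ρ σ β ^ (1 / (β * (1 - β))) : ℝ) : EReal)
          ≤ QRE.relEntropy ρ σ) ∧
      (∀ β : ℝ, 1 / 2 ≤ β → β < 1 →
        QRE.relEntropy (QRE.condExp N ρ) (QRE.condExp N σ)
          + ((QRE.constU β d * QRE.defect N ρ σ β ^ (2 / (1 - β)) : ℝ) : EReal)
          ≤ QRE.relEntropy ρ σ) ∧
      (QRE.relEntropy (QRE.condExp N ρ) (QRE.condExp N σ)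
          + (((Real.pi / 4) ^ 4 * (1 + d) ^ (-2 : ℝ)
              * QRE.hsNorm (QRE.mpow (QRE.condExp N σ) (1 / 2)
                  * QRE.mpow (QRE.condExp N ρ) (-(1 / 2)) * QRE.mpow ρ (1 / 2)
                  - QRE.mpow σ (1 / 2) * QRE.mpow ρ 0) ^ 4 : ℝ) : EReal)
          ≤ QRE.relEntropy ρ σ)) := by
  have half : ∀ {d : ℝ},
      (∀ β : ℝ, 1 / 2 ≤ β → β < 1 →
        QRE.relEntropy (QRE.condExp N ρ) (QRE.condExp N σ)
          + ((QRE.constU β d * QRE.defect N ρ σ β ^ (2 / (1 - β)) : ℝ) : EReal)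
          ≤ QRE.relEntropy ρ σ) →
      QRE.relEntropy (QRE.condExp N ρ) (QRE.condExp N σ)
          + (((Real.pi / 4) ^ 4 * (1 + d) ^ (-2 : ℝ)
              * QRE.hsNorm (QRE.mpow (QRE.condExp N σ) (1 / 2)
                  * QRE.mpow (QRE.condExp N ρ) (-(1 / 2)) * QRE.mpow ρ (1 / 2)
                  - QRE.mpow σ (1 / 2) * QRE.mpow ρ 0) ^ 4 : ℝ) : EReal)
          ≤ QRE.relEntropy ρ σ := by
    intro d h
    have := h (1 / 2) le_rfl (by norm_num)
    rwa [QRE.constU_half d, QRE.defect_half, show (2 : ℝ) / (1 - 1 / 2) = (4 : ℕ) by norm_num,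
      Real.rpow_natCast] at this
  refine ⟨fun hpos => ?_, fun d hd => ?_⟩
  · have hd0 := QRE.hsOpNorm_nonneg (QRE.relModular σ ρ)
    obtain ⟨h1, h2⟩ := QRE.relEntropy_condExp_add_le N hρ hσ hd0
      (QRE.mul_inv_eigenvalues_le_hsOpNorm hσ.1 hρ.1)
      -- Invertibility of ρ enters here: the norm for (σ, ρ) alone also bounds the eigenvalues for
      -- (σ_N, ρ_N).
      (QRE.mul_inv_eigenvalues_condExp_le hσ.1 hpos _ _)
    refine ⟨h1, h2, ?_⟩
    have h3 := half h2
    rwa [QRE.mpow_zero_of_posDef hpos, Matrix.mul_one] at h3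
  · have hd0 : 0 ≤ d := hd ▸ le_max_of_le_left (QRE.hsOpNorm_nonneg _)
    obtain ⟨h1, h2⟩ := QRE.relEntropy_condExp_add_le N hρ hσ hd0
      (fun j i => (QRE.mul_inv_eigenvalues_le_hsOpNorm hσ.1 hρ.1 j i).trans
        (hd ▸ le_max_left _ _))
      (fun j i => (QRE.mul_inv_eigenvalues_le_hsOpNorm (QRE.posSemidef_condExp hσ.1)
        (QRE.posSemidef_condExp hρ.1) j i).trans (hd ▸ le_max_right _ _))
    exact ⟨h1, h2, half h2⟩
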